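/- Let $\mathbb S=\{z\in\mathbb C:0<\operatorname{Re} z<1\}$ and let $\mathscr Z=\mathscr C(\ell_\infty,\ell_1)$ be the Calderón space of the couple $(\ell_\infty,\ell_1)$ of complex sequence spaces, that is, the space of bounded continuous functions $f:\overline{\mathbb S}\to\ell_\infty$ that are analytic on $\mathbb S$ and for which $t\mapsto f(1+it)$ is a bounded continuous function from $\mathbb R$ into $\ell_1$, with the norm $\|f\|_{\mathscr Z}=\sup\{\|f(it)\|_\infty,\|f(1+it)\|_1:t\in\mathbb R\}$. For $m\ge 1$ let $$\mathscr Z_m=\Big\{\Big(\tfrac{f^{(m-1)}(1/2)}{(m-1)!},\dots,f'(1/2),f(1/2)\Big): f\in\mathscr Z\Big\}\subset \ell_\infty^m$$ be the $m$-th Rochberg space of the couple at $1/2$, where the norm of $w$ is the infimum of $\|f\|_{\mathscr Z}$ over all $f\in\mathscr Z$ whose list of Taylor coefficients at $1/2$ is $w$. A twisted Hilbert space of order $1$ is a complex Banach space isomorphic to a Hilbert space. For $k\ge2$, a complex Banach space $Z$ is a twisted Hilbert space of order $k$ if for some $i,j\ge1$ with $i+j=k$ there is a short exact sequence $0\to A\to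 Z\to B\to 0$ of Banach spaces and bounded operators in which $A$ and $B$ are twisted Hilbert spaces of orders $i$ and $j$, respectively. **Theorem.** Let $1\le k<m$. Then $\mathscr Z_m$ is not isomorphic to a subspace of any twisted Hilbert space of order $k$. In particular, $\mathscr Z_m$ is not isomorphic to a subspace of $\mathscr Z_k$. -/

import Mathlib

open scoped ENNReal

noncomputable section

/-- The complex Banach space `ℓ_∞`. -/
abbrev EllInfty : Type := lp (fun _ : ℕ => ℂ) ∞

/-- The complex Banach space `ℓ_1`. -/
abbrev EllOne : Type := lp (fun _ : ℕ => ℂ) 1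

/-- The open unit strip `0 < Re z < 1`. -/
def openStrip : Set ℂ := {z | 0 < z.re ∧ z.re < 1}

/-- The closed unit strip `0 ≤ Re z ≤ 1`. -/
def closedStrip : Set ℂ := {z | 0 ≤ z.re ∧ z.re ≤ 1}

/-- The boundary point `it` of the strip. -/
def leftPt (t : ℝ) : ℂ := t * Complex.I

/-- The boundary point `1 + it` of the strip. -/
def rightPt (t : ℝ) : ℂ := 1 + t * Complex.I

/-- Membership in the Calderón space of the couple `(ℓ_∞, ℓ_1)` on the unit strip: `f` is continuous
and bounded on the closed strip with values in `ℓ_∞`, analytic in its interior, and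
`t ↦ f (1 + it)` is a bounded continuous function with values in `ℓ_1`. (That `t ↦ f (it)` is bounded
and continuous into `ℓ_∞` is contained in the first conditions.) A function on the closed strip is
represented by its extension by zero to `ℂ`. -/
structure IsCalderon (f : ℂ → EllInfty) : Prop where
  zero_off : ∀ z, z ∉ closedStrip → f z = 0
  continuousOn : ContinuousOn f closedStrip
  differentiableOn : DifferentiableOn ℂ f openStrip
  bounded : ∃ C : ℝ, ∀ z ∈ closedStrip, ‖f z‖ ≤ C
  trace : ∃ g : BoundedContinuousFunction ℝ EllOne, ∀ (t : ℝ) (n : ℕ), g t n = f (rightPt t) n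

/-- The Calderón space as a space of functions. -/
def calderonSubmodule : Submodule ℂ (ℂ → EllInfty) where
  carrier := {f | IsCalderon f}
  zero_mem' := ⟨fun _ _ => rfl, continuousOn_const, differentiableOn_const _,
    ⟨0, fun _ _ => by simp⟩, ⟨0, fun _ _ => by simp⟩⟩
  add_mem' := by
    rintro f g hf hg
    obtain ⟨C, hC⟩ := hf.bounded
    obtain ⟨D, hD⟩ := hg.bounded
    obtain ⟨u, hu⟩ := hf.trace
    obtain ⟨v, hv⟩ := hg.trace
    exact ⟨fun z hz => by simp [hf.zero_off z hz, hg.zero_off z hz],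
      hf.continuousOn.add hg.continuousOn, hf.differentiableOn.add hg.differentiableOn,
      ⟨C + D, fun z hz => (norm_add_le _ _).trans (add_le_add (hC z hz) (hD z hz))⟩,
      ⟨u + v, fun t n => by simp [hu, hv]⟩⟩
  smul_mem' := by
    rintro c f hf
    obtain ⟨C, hC⟩ := hf.bounded
    obtain ⟨u, hu⟩ := hf.trace
    exact ⟨fun z hz => by simp [hf.zero_off z hz],
      hf.continuousOn.const_smul c, hf.differentiableOn.const_smul c,
      ⟨‖c‖ * C, fun z hz => by
        rw [Pi.smul_apply, norm_smul]
        exact mul_le_mul_of_nonneg_left (hC z hz) (norm_nonneg _)⟩,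
      ⟨c • u, fun t n => by simp [hu]⟩⟩

/-- The Calderón space `𝒵 = 𝒞(ℓ_∞, ℓ_1)` on the unit strip. -/
def CalderonSpace : Type := calderonSubmodule

namespace CalderonSpace

instance : AddCommGroup CalderonSpace := inferInstanceAs (AddCommGroup calderonSubmodule)
instance : Module ℂ CalderonSpace := inferInstanceAs (Module ℂ calderonSubmodule)

instance : CoeFun CalderonSpace (fun _ => ℂ → EllInfty) := ⟨fun f => f.1⟩

theorem add_apply (f g : CalderonSpace) (z : ℂ) : (f + g) z = f z + g z := rfl
theorem smul_apply (c : ℂ) (f : CalderonSpace) (z : ℂ) : (c • f) z = c • f z := rfl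

theorem isCalderon (f : CalderonSpace) : IsCalderon (f : ℂ → EllInfty) := f.2

/-- The larger of `‖f(it)‖_∞` and `‖f(1+it)‖_1`. -/
def bdry (f : CalderonSpace) (t : ℝ) : ℝ := max ‖f (leftPt t)‖ (∑' n, ‖f (rightPt t) n‖)

/-- The Calderón norm `sup {‖f(it)‖_∞, ‖f(1+it)‖_1 : t ∈ ℝ}`. -/
instance : Norm CalderonSpace := ⟨fun f => ⨆ t : ℝ, bdry f t⟩

theorem norm_def (f : CalderonSpace) : ‖f‖ = ⨆ t : ℝ, bdry f t := rfl

theorem leftPt_mem (t : ℝ) : leftPt t ∈ closedStrip := by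
  constructor <;> simp [leftPt]

theorem rightPt_mem (t : ℝ) : rightPt t ∈ closedStrip := by
  constructor <;> simp [rightPt]

theorem ellOne_norm (x : EllOne) : Summable (fun n => ‖x n‖) ∧ ‖x‖ = ∑' n, ‖x n‖ := by
  have h1 : (0 : ℝ) < (1 : ℝ≥0∞).toReal := by simp
  refine ⟨?_, ?_⟩
  · simpa using (lp.memℓp x).summable h1
  · simpa using lp.norm_eq_tsum_rpow h1 x

theorem summable_right (f : CalderonSpace) (t : ℝ) : Summable (fun n => ‖f (rightPt t) n‖) := by
  obtain ⟨g, hg⟩ := f.isCalderon.trace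
  simpa [hg] using (ellOne_norm (g t)).1

theorem bddAbove_bdry (f : CalderonSpace) : BddAbove (Set.range (bdry f)) := by
  obtain ⟨C, hC⟩ := f.isCalderon.bounded
  obtain ⟨g, hg⟩ := f.isCalderon.trace
  refine ⟨max C ‖g‖, ?_⟩
  rintro _ ⟨t, rfl⟩
  refine max_le_max (hC _ (leftPt_mem t)) ?_
  have h := (ellOne_norm (g t)).2
  simp only [hg] at h
  exact h ▸ g.norm_coe_le_norm t

theorem left_le (f : CalderonSpace) (t : ℝ) : ‖f (leftPt t)‖ ≤ ‖f‖ :=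
  (le_max_left _ _).trans (le_ciSup (bddAbove_bdry f) t)

theorem right_le (f : CalderonSpace) (t : ℝ) : ∑' n, ‖f (rightPt t) n‖ ≤ ‖f‖ :=
  (le_max_right _ _).trans (le_ciSup (bddAbove_bdry f) t)

theorem norm_le {f : CalderonSpace} {C : ℝ} (h0 : ∀ t, ‖f (leftPt t)‖ ≤ C)
    (h1 : ∀ t, ∑' n, ‖f (rightPt t) n‖ ≤ C) : ‖f‖ ≤ C :=
  ciSup_le fun t => max_le (h0 t) (h1 t)

theorem norm_nonneg' (f : CalderonSpace) : 0 ≤ ‖f‖ := (norm_nonneg _).trans (left_le f 0)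

theorem norm_add_le' (f g : CalderonSpace) : ‖f + g‖ ≤ ‖f‖ + ‖g‖ := by
  refine norm_le (fun t => ?_) fun t => ?_
  · exact (norm_add_le _ _).trans (add_le_add (left_le f t) (left_le g t))
  · have h : ∀ n, ‖(f + g) (rightPt t) n‖ ≤ ‖f (rightPt t) n‖ + ‖g (rightPt t) n‖ := fun n => by
      rw [add_apply]; exact norm_add_le _ _
    have hs := (summable_right f t).add (summable_right g t)
    calc _ ≤ ∑' n, (‖f (rightPt t) n‖ + ‖g (rightPt t) n‖) :=
          (summable_right (f + g) t).tsum_le_tsum h hs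
      _ = _ := (summable_right f t).tsum_add (summable_right g t)
      _ ≤ _ := add_le_add (right_le f t) (right_le g t)

theorem norm_smul_le' (c : ℂ) (f : CalderonSpace) : ‖c • f‖ ≤ ‖c‖ * ‖f‖ := by
  refine norm_le (fun t => ?_) fun t => ?_
  · rw [smul_apply, norm_smul]
    exact mul_le_mul_of_nonneg_left (left_le f t) (norm_nonneg _)
  · have h : ∀ n, ‖(c • f) (rightPt t) n‖ = ‖c‖ * ‖f (rightPt t) n‖ := fun n => by
      rw [smul_apply, lp.coeFn_smul, Pi.smul_apply, norm_smul]
    simp only [h, tsum_mul_left]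
    exact mul_le_mul_of_nonneg_left (right_le f t) (norm_nonneg _)

theorem norm_le_of_mem (f : CalderonSpace) {z : ℂ} (hz : z ∈ closedStrip) : ‖f z‖ ≤ ‖f‖ := by
  have ho : openStrip = Complex.re ⁻¹' Set.Ioo 0 1 := rfl
  have hc : closure (Complex.re ⁻¹' Set.Ioo (0 : ℝ) 1) = closedStrip := by
    rw [Complex.closure_preimage_re, closure_Ioo zero_ne_one]; rfl
  obtain ⟨C, hC⟩ := f.isCalderon.bounded
  refine PhragmenLindelof.vertical_strip (f := (f : ℂ → EllInfty)) (a := 0) (b := 1)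
    ⟨f.isCalderon.differentiableOn, by rw [hc]; exact f.isCalderon.continuousOn⟩ ?_ ?_ ?_ hz.1 hz.2
  · refine ⟨0, by simpa using Real.pi_pos, 0, ?_⟩
    refine Asymptotics.IsBigO.of_bound C ?_
    rw [Filter.eventually_inf_principal]
    refine Filter.Eventually.of_forall fun w hw => ?_
    simpa using hC w ⟨hw.1.le, hw.2.le⟩
  · intro w hw
    have : w = leftPt w.im := by apply Complex.ext <;> simp [leftPt, hw]
    rw [this]; exact left_le f _
  · intro w hw
    have : w = rightPt w.im := by apply Complex.ext <;> simp [rightPt, hw]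
    rw [this]
    refine lp.norm_le_of_forall_le f.norm_nonneg' fun n => ?_
    exact ((summable_right f _).le_tsum n fun _ _ => norm_nonneg _).trans (right_le f _)

theorem core : NormedSpace.Core ℂ CalderonSpace where
  norm_nonneg := norm_nonneg'
  norm_smul c f := by
    refine le_antisymm (norm_smul_le' c f) ?_
    rcases eq_or_ne c 0 with rfl | hc
    · simpa using norm_nonneg' _
    · have h := norm_smul_le' c⁻¹ (c • f)
      rw [inv_smul_smul₀ hc, norm_inv] at h
      rwa [← le_inv_mul_iff₀ (norm_pos_iff.2 hc)]
  norm_triangle := norm_add_le'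
  norm_eq_zero_iff f := by
    refine ⟨fun h => ?_, ?_⟩
    · refine Subtype.ext (funext fun z => ?_)
      by_cases hz : z ∈ closedStrip
      · exact norm_le_zero_iff.1 (h ▸ norm_le_of_mem f hz)
      · exact f.isCalderon.zero_off z hz
    · rintro rfl
      have := norm_smul_le' 0 (0 : CalderonSpace)
      rw [zero_smul, norm_zero, zero_mul] at this
      exact le_antisymm this (norm_nonneg' _)

instance : NormedAddCommGroup CalderonSpace := NormedAddCommGroup.ofCore core
instance : NormedSpace ℂ CalderonSpace := NormedSpace.ofCore core

theorem isOpen_openStrip : IsOpen openStrip :=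
  (isOpen_lt continuous_const Complex.continuous_re).inter
    (isOpen_lt Complex.continuous_re continuous_const)

theorem half_mem : (1 / 2 : ℂ) ∈ openStrip := by
  have : (1 / 2 : ℂ).re = 1 / 2 := by norm_num
  constructor <;> rw [this] <;> norm_num

theorem contDiffAt_half (f : CalderonSpace) (i : ℕ) :
    ContDiffAt ℂ i (f : ℂ → EllInfty) (1 / 2) :=
  (f.isCalderon.differentiableOn.analyticAt (isOpen_openStrip.mem_nhds half_mem)).contDiffAt

/-- The list of Taylor coefficients `f^{(i)}(1/2) / i!`, `0 ≤ i < m`; the coefficient of index `i`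
sits in the coordinate `i`. -/
def taylor (m : ℕ) : CalderonSpace →ₗ[ℂ] (Fin m → EllInfty) where
  toFun f i := ((i : ℕ).factorial : ℂ)⁻¹ • iteratedDeriv (i : ℕ) (f : ℂ → EllInfty) (1 / 2)
  map_add' f g := by
    funext i
    have h := iteratedDeriv_add (contDiffAt_half f i) (contDiffAt_half g i)
    change _ • iteratedDeriv (i : ℕ) ((f : ℂ → EllInfty) + (g : ℂ → EllInfty)) (1 / 2) = _
    rw [h, smul_add]; rfl
  map_smul' c f := by
    funext i
    have h := iteratedDeriv_const_smul (contDiffAt_half f i) c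
    change _ • iteratedDeriv (i : ℕ) (c • (f : ℂ → EllInfty)) (1 / 2) = _
    rw [h, smul_comm]; rfl

theorem norm_taylor_le {m : ℕ} (f : CalderonSpace) (i : Fin m) :
    ‖taylor m f i‖ ≤ 4 ^ (i : ℕ) * ‖f‖ := by
  have hball : Metric.closedBall (1 / 2 : ℂ) (1 / 4) ⊆ openStrip := by
    intro z hz
    rw [Metric.mem_closedBall, dist_eq_norm] at hz
    have h := abs_le.1 ((Complex.abs_re_le_norm _).trans hz)
    have h2 : (z - 1 / 2).re = z.re - 1 / 2 := by norm_num
    rw [h2] at h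
    constructor <;> linarith [h.1, h.2]
  have hsub : openStrip ⊆ closedStrip := fun z hz => ⟨hz.1.le, hz.2.le⟩
  have hd : DiffContOnCl ℂ (f : ℂ → EllInfty) (Metric.ball (1 / 2 : ℂ) (1 / 4)) :=
    (f.isCalderon.differentiableOn.mono hball).diffContOnCl_ball le_rfl
  have h := Complex.norm_iteratedDeriv_le_of_forall_mem_sphere_norm_le (i : ℕ) (by norm_num) hd
    (C := ‖f‖) fun z hz => norm_le_of_mem f (hsub (hball (Metric.sphere_subset_closedBall hz)))
  have hf : (0 : ℝ) < ((i : ℕ).factorial : ℝ) := by exact_mod_cast (i : ℕ).factorial_pos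
  change ‖((i : ℕ).factorial : ℂ)⁻¹ • iteratedDeriv (i : ℕ) (f : ℂ → EllInfty) (1 / 2)‖ ≤ _
  rw [norm_smul, norm_inv, Complex.norm_natCast, inv_mul_le_iff₀ hf]
  refine h.trans (le_of_eq ?_)
  rw [one_div, inv_pow, div_inv_eq_mul]; ring

end CalderonSpace

open CalderonSpace in
/-- The Rochberg space `𝒵_m` of the couple `(ℓ_∞, ℓ_1)` at `1/2`: all lists of the first `m` Taylor
coefficients at `1/2` of the functions in the Calderón space. -/
def RochbergSpace (m : ℕ) : Type := LinearMap.range (taylor m)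

namespace RochbergSpace

open CalderonSpace

variable {m : ℕ}

instance : AddCommGroup (RochbergSpace m) := inferInstanceAs (AddCommGroup (LinearMap.range (taylor m)))
instance : Module ℂ (RochbergSpace m) := inferInstanceAs (Module ℂ (LinearMap.range (taylor m)))

/-- The quotient norm: `‖w‖` is the infimum of the norms of the functions `f` in the Calderón space
whose list of Taylor coefficients is `w`. -/
instance : Norm (RochbergSpace m) :=
  ⟨fun w => ⨅ f : {f : CalderonSpace // taylor m f = w.1}, ‖f.1‖⟩

theorem norm_le {w : RochbergSpace m} {f : CalderonSpace} (h : taylor m f = w.1) : ‖w‖ ≤ ‖f‖ :=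
  ciInf_le (f := fun f : {f : CalderonSpace // taylor m f = w.1} => ‖f.1‖)
    ⟨0, by rintro _ ⟨g, rfl⟩; exact norm_nonneg _⟩ ⟨f, h⟩

theorem le_norm {w : RochbergSpace m} {C : ℝ}
    (h : ∀ f : CalderonSpace, taylor m f = w.1 → C ≤ ‖f‖) : C ≤ ‖w‖ := by
  obtain ⟨f, hf⟩ := w.2
  have : Nonempty {f : CalderonSpace // taylor m f = w.1} := ⟨⟨f, hf⟩⟩
  exact le_ciInf fun f => h f.1 f.2

theorem norm_nonneg' (w : RochbergSpace m) : 0 ≤ ‖w‖ := le_norm fun _ _ => norm_nonneg _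

theorem norm_smul_le' (c : ℂ) (w : RochbergSpace m) : ‖c • w‖ ≤ ‖c‖ * ‖w‖ := by
  rcases eq_or_ne c 0 with rfl | hc
  · rw [zero_smul, norm_zero, zero_mul]
    simpa using norm_le (w := (0 : RochbergSpace m)) (f := 0) (map_zero _)
  · rw [← inv_mul_le_iff₀ (norm_pos_iff.2 hc)]
    refine le_norm fun f hf => ?_
    rw [inv_mul_le_iff₀ (norm_pos_iff.2 hc), ← norm_smul]
    exact norm_le (by rw [map_smul, hf]; rfl)

theorem core : NormedSpace.Core ℂ (RochbergSpace m) where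
  norm_nonneg := norm_nonneg'
  norm_smul c w := by
    refine le_antisymm (norm_smul_le' c w) ?_
    rcases eq_or_ne c 0 with rfl | hc
    · simpa using norm_nonneg' _
    · have h := norm_smul_le' c⁻¹ (c • w)
      rw [inv_smul_smul₀ hc, norm_inv] at h
      rwa [← le_inv_mul_iff₀ (norm_pos_iff.2 hc)]
  norm_triangle v w := by
    rw [← sub_le_iff_le_add]
    refine le_norm fun g hg => ?_
    rw [sub_le_comm]
    refine le_norm fun f hf => ?_
    rw [sub_le_iff_le_add]
    exact (norm_le (f := g + f) (by rw [map_add, hg, hf]; rfl)).trans ((norm_add_le g f).trans (add_comm _ _).le)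
  norm_eq_zero_iff w := by
    refine ⟨fun h => ?_, ?_⟩
    · refine Subtype.ext (funext fun i => ?_)
      have : (4 ^ (i : ℕ))⁻¹ * ‖w.1 i‖ ≤ ‖w‖ := le_norm fun f hf => by
        rw [inv_mul_le_iff₀ (by positivity), ← hf]
        exact norm_taylor_le f i
      rw [h, inv_mul_le_iff₀ (by positivity), mul_zero] at this
      exact norm_le_zero_iff.1 this
    · rintro rfl
      have := norm_smul_le' 0 (0 : RochbergSpace m)
      rw [zero_smul, norm_zero, zero_mul] at this
      exact le_antisymm this (norm_nonneg' _)

instance : NormedAddCommGroup (RochbergSpace m) := NormedAddCommGroup.ofCore core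
instance : NormedSpace ℂ (RochbergSpace m) := NormedSpace.ofCore core

end RochbergSpace

/-- Twisted Hilbert spaces of order `k`. Order `1`: Banach spaces linearly homeomorphic to a Hilbert
space. Order `i + j` with `i, j ≥ 1`: Banach spaces `Z` that are the middle term of a short exact
sequence `0 → A → Z → B → 0` of Banach spaces and bounded operators, with `A` and `B` twisted
Hilbert spaces of order `i` and `j`. No space has order `0`. -/
inductive IsTwistedHilbert.{u} :
    ℕ → ∀ (Z : Type u) [NormedAddCommGroup Z] [NormedSpace ℂ Z], Prop
  | hilbert (Z H : Type u) [NormedAddCommGroup Z] [NormedSpace ℂ Z] [CompleteSpace Z]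
      [NormedAddCommGroup H] [InnerProductSpace ℂ H] [CompleteSpace H] (e : Z ≃L[ℂ] H) :
      IsTwistedHilbert 1 Z
  | twist (i j : ℕ) (A Z B : Type u) [NormedAddCommGroup A] [NormedSpace ℂ A]
      [NormedAddCommGroup Z] [NormedSpace ℂ Z] [CompleteSpace Z]
      [NormedAddCommGroup B] [NormedSpace ℂ B]
      (hi : 1 ≤ i) (hj : 1 ≤ j) (hA : IsTwistedHilbert i A) (hB : IsTwistedHilbert j B)
      (ι : A →L[ℂ] Z) (π : Z →L[ℂ] B) (h_inj : Function.Injective ι)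
      (h_exact : Function.Exact ι π) (h_surj : Function.Surjective π) :
      IsTwistedHilbert (i + j) Z

/-- `X` embeds in `Y`: some bounded linear operator `X → Y` is an isomorphism onto its image. -/
def EmbedsIn (X Y : Type*) [NormedAddCommGroup X] [NormedSpace ℂ X]
    [NormedAddCommGroup Y] [NormedSpace ℂ Y] : Prop :=
  ∃ T : X →L[ℂ] Y, ∃ c : ℝ, 0 < c ∧ ∀ x, c * ‖x‖ ≤ ‖T x‖

end

/-! The invariant is the type 2 constant on n = 2^r vectors: the least T_n for which the mean of ‖∑
±x_i‖² is at most T_n² ∑ ‖x_i‖². `HasLogType Z d` says T_n = O((log n)^d), with r + 1 in the role of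
log n. It passes to subspaces, so it suffices to bound it above for the target and below for
`RochbergSpace m`.

Upper bound. Hilbert spaces have exponent 0 by the parallelogram law. If the kernel and the quotient
have exponents d and e, the middle space has exponent d + e + 1 (`HasLogType.extension`). To see
this, lift the quotient vectors by a bounded, not additive, map L and sum them pairwise along a
binary tree. At each of the r levels the failure of additivity of L lies in the kernel and is
controlled by its type. Hence order k gives exponent k - 1. For the Rochberg spaces the same lemma
applies to 0 → 𝒵_k → 𝒵_{k+1} → ℓ_2 → 0, where the quotient map is evaluation at 1/2 and the kernel
is reached by multiplication with a function having a simple zero there; thus 𝒵_k has exponent k -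
1.

Lower bound. In 𝒵_{p+1} take the jets of n constant functions with unit vector values; their norms
are at most 1. If f has the jet of a signed sum of them, pair f with the same signs and multiply by
n^z. The result is bounded by n‖f‖ on the strip, while its p-th derivative at 1/2 is n·√n·(log n)^p.
Cauchy's estimate gives ‖f‖ ≥ c √n (log n)^p (`le_norm_sum_unit`), so no exponent below p = m - 1 is
possible. -/

noncomputable section

open Finset Filter Topology
open scoped BigOperators

/-! ### Quadratic averages over signs -/

/-- The mean of `‖∑ ε_i x_i‖²` over all choices of signs `ε`. -/
def sqAvg {ι Z : Type*} [Fintype ι] [DecidableEq ι] [SeminormedAddCommGroup Z] (x : ι → Z) : ℝ :=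
  𝔼 ε : ι → ℤˣ, ‖∑ i, ε i • x i‖ ^ 2

section SqAvg

variable {ι Z Y : Type*} [Fintype ι] [DecidableEq ι] [SeminormedAddCommGroup Z] [SeminormedAddCommGroup Y]

theorem norm_intUnits_smul (u : ℤˣ) (x : Z) : ‖u • x‖ = ‖x‖ := by
  rcases Int.units_eq_one_or u with rfl | rfl
  · simp
  · simp [Units.smul_def]

theorem sqAvg_nonneg (x : ι → Z) : 0 ≤ sqAvg x :=
  expect_nonneg fun _ _ => by positivity

theorem sqAvg_le_of_forall {x : ι → Z} {C : ℝ} (h : ∀ ε : ι → ℤˣ, ‖∑ i, ε i • x i‖ ^ 2 ≤ C) :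
    sqAvg x ≤ C :=
  expect_le univ_nonempty fun ε _ => h ε

theorem le_sqAvg_of_forall {x : ι → Z} {C : ℝ} (h : ∀ ε : ι → ℤˣ, C ≤ ‖∑ i, ε i • x i‖ ^ 2) :
    C ≤ sqAvg x :=
  le_expect univ_nonempty fun ε _ => h ε

theorem sqAvg_le_mul {x : ι → Z} {y : ι → Y} {C : ℝ}
    (h : ∀ ε : ι → ℤˣ, ‖∑ i, ε i • x i‖ ≤ C * ‖∑ i, ε i • y i‖) :
    sqAvg x ≤ C ^ 2 * sqAvg y := by
  unfold sqAvg
  rw [mul_expect]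
  refine expect_le_expect fun ε _ => ?_
  rw [← mul_pow]
  exact pow_le_pow_left₀ (norm_nonneg _) (h ε) 2

/-- Young's inequality with t left free: letting t grow with the tree level keeps the accumulated
constants polynomial in r. -/
theorem norm_add_sq_le {a b : Z} {t : ℝ} (ht : 0 < t) :
    ‖a + b‖ ^ 2 ≤ (1 + 1 / t) * ‖a‖ ^ 2 + (1 + t) * ‖b‖ ^ 2 := by
  have h1 := pow_le_pow_left₀ (norm_nonneg _) (norm_add_le a b) 2
  have h2 : 0 ≤ (‖a‖ - t * ‖b‖) ^ 2 / t := by positivity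
  have h3 : (‖a‖ - t * ‖b‖) ^ 2 / t = 1 / t * ‖a‖ ^ 2 + t * ‖b‖ ^ 2 - 2 * ‖a‖ * ‖b‖ := by
    field_simp; ring
  nlinarith

theorem sqAvg_add_le (x y : ι → Z) {t : ℝ} (ht : 0 < t) :
    sqAvg (fun i => x i + y i) ≤ (1 + 1 / t) * sqAvg x + (1 + t) * sqAvg y := by
  unfold sqAvg
  rw [mul_expect, mul_expect, ← expect_add_distrib]
  refine expect_le_expect fun ε _ => ?_
  simp only [smul_add, sum_add_distrib]
  exact norm_add_sq_le ht

/-- A family indexed by `ι × Bool`, paired up with relative signs `θ`. -/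
def pairUp (x : ι × Bool → Z) (θ : ι → ℤˣ) (i : ι) : Z := x (i, false) + θ i • x (i, true)

/-- Signs on `ι × Bool` as relative signs within pairs and signs of the pairs. -/
def signsEquiv (ι : Type*) : (ι → ℤˣ) × (ι → ℤˣ) ≃ (ι × Bool → ℤˣ) where
  toFun p q := if q.2 then p.2 q.1 * p.1 q.1 else p.2 q.1
  invFun ε := (fun i => ε (i, false) * ε (i, true), fun i => ε (i, false))
  left_inv p := by
    ext i <;> simp [← mul_assoc]
  right_inv ε := by
    ext ⟨i, b⟩
    cases b <;> simp [← mul_assoc]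

/-- Uniform signs on all indices amount to independent uniform relative signs within the pairs and
signs of the pairs. This is the induction step of every argument along the binary tree. -/
theorem sqAvg_eq_expect_pairUp (x : ι × Bool → Z) :
    sqAvg x = 𝔼 θ : ι → ℤˣ, sqAvg (pairUp x θ) := by
  unfold sqAvg
  rw [← expect_product', univ_product_univ]
  refine (Fintype.expect_equiv (signsEquiv ι) _ _ fun p => ?_).symm
  rw [Fintype.sum_prod_type]
  simp [signsEquiv, pairUp, mul_smul, add_comm]

end SqAvg

/-! ### Dyadic index sets and logarithmic type 2 -/

/-- An index type with `2 ^ r` elements, organised by repeated pairing. -/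
def DyadicIdx : ℕ → Type
  | 0 => Unit
  | r + 1 => DyadicIdx r × Bool

namespace DyadicIdx

instance instFintype : ∀ r, Fintype (DyadicIdx r)
  | 0 => inferInstanceAs (Fintype Unit)
  | r + 1 => @instFintypeProd _ _ (instFintype r) _

instance instDecidableEq : ∀ r, DecidableEq (DyadicIdx r)
  | 0 => inferInstanceAs (DecidableEq Unit)
  | r + 1 => @instDecidableEqProd _ _ (instDecidableEq r) _

theorem card (r : ℕ) : Fintype.card (DyadicIdx r) = 2 ^ r := by
  induction r with
  | zero => rfl
  | succ r ih =>
    have : Fintype.card (DyadicIdx r × Bool) = 2 ^ (r + 1) := by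
      rw [Fintype.card_prod, ih, Fintype.card_bool, pow_succ]
    exact this

/-- The only index in `DyadicIdx 0`. -/
def root : DyadicIdx 0 := ()

theorem sum_zero {M : Type*} [AddCommMonoid M] (g : DyadicIdx 0 → M) : ∑ i, g i = g root :=
  Fintype.sum_unique (ι := Unit) g

theorem sum_succ {M : Type*} [AddCommMonoid M] {r : ℕ} (g : DyadicIdx r × Bool → M) :
    (∑ q : DyadicIdx (r + 1), g q) = ∑ i, (g (i, false) + g (i, true)) :=
  (Fintype.sum_prod_type g).trans (sum_congr rfl fun _ _ => by rw [Fintype.sum_bool, add_comm])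

end DyadicIdx

/-- The type `2` constants on `2 ^ r` vectors grow at most like `(r + 1) ^ d`. -/
def HasLogType (Z : Type*) [SeminormedAddCommGroup Z] (d : ℕ) : Prop :=
  ∃ C : ℝ, 0 ≤ C ∧ ∀ (r : ℕ) (x : DyadicIdx r → Z),
    sqAvg x ≤ C * ((r : ℝ) + 1) ^ (2 * d) * ∑ i, ‖x i‖ ^ 2

/-- The relative signs θ and -θ are equally likely, and the parallelogram law in each pair makes
their two contributions add up exactly. -/
theorem sqAvg_le_of_inner {H : Type*} [NormedAddCommGroup H] [InnerProductSpace ℂ H] (r : ℕ)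
    (x : DyadicIdx r → H) : sqAvg x ≤ ∑ i, ‖x i‖ ^ 2 := by
  induction r with
  | zero =>
    refine sqAvg_le_of_forall fun ε => le_of_eq ?_
    rw [DyadicIdx.sum_zero, DyadicIdx.sum_zero, norm_intUnits_smul]
  | succ r ih =>
    have hpar : ∀ θ : DyadicIdx r → ℤˣ, ∑ i, ‖pairUp x θ i‖ ^ 2 + ∑ i, ‖pairUp x (-θ) i‖ ^ 2
        = 2 * ∑ q, ‖x q‖ ^ 2 := fun θ => by
      have hx : ∑ q, ‖x q‖ ^ 2 = ∑ i, (‖x (i, false)‖ ^ 2 + ‖x (i, true)‖ ^ 2) :=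
        DyadicIdx.sum_succ fun q => ‖x q‖ ^ 2
      rw [hx, ← sum_add_distrib, mul_sum]
      refine sum_congr rfl fun i _ => ?_
      have h := parallelogram_law_with_norm ℂ (x (i, false)) (θ i • x (i, true))
      rw [norm_intUnits_smul] at h
      have h0 : pairUp x θ i = x (i, false) + θ i • x (i, true) := rfl
      have h1 : pairUp x (-θ) i = x (i, false) + (-θ i) • x (i, true) := rfl
      rw [h0, h1, Units.neg_smul, ← sub_eq_add_neg]
      linarith
    have hneg : 𝔼 θ : DyadicIdx r → ℤˣ, ∑ i, ‖pairUp x (-θ) i‖ ^ 2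
        = 𝔼 θ : DyadicIdx r → ℤˣ, ∑ i, ‖pairUp x θ i‖ ^ 2 :=
      Fintype.expect_equiv (Equiv.neg _) _ _ fun _ => rfl
    have hsum : 𝔼 θ : DyadicIdx r → ℤˣ, ∑ i, ‖pairUp x θ i‖ ^ 2 = ∑ q, ‖x q‖ ^ 2 := by
      have h := (expect_congr rfl fun θ _ => hpar θ).trans
        (Fintype.expect_const (ι := DyadicIdx r → ℤˣ) _)
      rw [expect_add_distrib, hneg] at h
      linarith
    calc sqAvg x = 𝔼 θ : DyadicIdx r → ℤˣ, sqAvg (pairUp x θ) := sqAvg_eq_expect_pairUp x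
      _ ≤ 𝔼 θ : DyadicIdx r → ℤˣ, ∑ i, ‖pairUp x θ i‖ ^ 2 := expect_le_expect fun θ _ => ih _
      _ = _ := hsum

theorem hasLogType_of_inner (H : Type*) [NormedAddCommGroup H] [InnerProductSpace ℂ H] :
    HasLogType H 0 :=
  ⟨1, zero_le_one, fun r x => by simpa using sqAvg_le_of_inner r x⟩

/-- Transfer of logarithmic type along a map that controls signed sums. -/
theorem HasLogType.transfer {A K : Type*} [SeminormedAddCommGroup A] [SeminormedAddCommGroup K]
    {d : ℕ} (h : HasLogType A d) (f : K → A) (C : ℝ) (hf : ∀ x, ‖f x‖ ≤ C * ‖x‖)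
    (hs : ∀ (r : ℕ) (x : DyadicIdx r → K) (ε : DyadicIdx r → ℤˣ),
      ‖∑ i, ε i • x i‖ ≤ C * ‖∑ i, ε i • f (x i)‖) : HasLogType K d := by
  obtain ⟨D, hD, h⟩ := h
  refine ⟨C ^ 2 * D * C ^ 2, by positivity, fun r x => ?_⟩
  calc sqAvg x ≤ C ^ 2 * sqAvg (fun i => f (x i)) := sqAvg_le_mul (hs r x)
    _ ≤ C ^ 2 * (D * ((r : ℝ) + 1) ^ (2 * d) * ∑ i, ‖f (x i)‖ ^ 2) := by
        gcongr; exact h r _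
    _ ≤ C ^ 2 * (D * ((r : ℝ) + 1) ^ (2 * d) * ∑ i, (C * ‖x i‖) ^ 2) := by
        gcongr with i; exact hf _
    _ = _ := by simp only [mul_pow, ← mul_sum]; ring

theorem map_intUnits_smul {A K F : Type*} [AddCommGroup A] [AddCommGroup K] [FunLike F A K]
    [AddMonoidHomClass F A K] (f : F) (u : ℤˣ) (x : A) : f (u • x) = u • f x := by
  simp only [Units.smul_def, map_zsmul]

theorem map_sum_intUnits_smul {A K F ι : Type*} [Fintype ι] [AddCommGroup A] [AddCommGroup K]
    [FunLike F A K] [AddMonoidHomClass F A K] (f : F) (ε : ι → ℤˣ) (x : ι → A) :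
    f (∑ i, ε i • x i) = ∑ i, ε i • f (x i) := by
  simp only [map_sum, map_intUnits_smul]

theorem sqAvg_coe {Z ι : Type*} [Fintype ι] [DecidableEq ι] [SeminormedAddCommGroup Z]
    [NormedSpace ℂ Z] {K : Submodule ℂ Z} (x : ι → K) :
    sqAvg (fun i => (x i : Z)) = sqAvg x := by
  refine expect_congr rfl fun ε _ => ?_
  have h : ∑ i, ε i • (x i : Z) = ((∑ i, ε i • x i : K) : Z) :=
    (map_sum_intUnits_smul K.subtype ε x).symm
  rw [h]; rfl

/-- Logarithmic type passes to subspaces. -/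
theorem HasLogType.of_antilipschitz {A K : Type*} [SeminormedAddCommGroup A] [NormedSpace ℂ A]
    [SeminormedAddCommGroup K] [NormedSpace ℂ K] {d : ℕ} (h : HasLogType A d) (T : K →L[ℂ] A)
    {c : ℝ} (hc : 0 < c) (hT : ∀ x, c * ‖x‖ ≤ ‖T x‖) : HasLogType K d := by
  refine h.transfer T (max ‖T‖ c⁻¹) (fun x => (T.le_opNorm x).trans ?_) fun r x ε => ?_
  · gcongr; exact le_max_left _ _
  · rw [← map_sum_intUnits_smul]
    calc _ ≤ c⁻¹ * ‖T (∑ i, ε i • x i)‖ := by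
          rw [← div_eq_inv_mul, le_div_iff₀ hc, mul_comm]; exact hT _
      _ ≤ _ := by gcongr; exact le_max_right _ _

/-- Logarithmic type passes to quotients. -/
theorem HasLogType.of_lift {A K : Type*} [SeminormedAddCommGroup A] [NormedSpace ℂ A]
    [SeminormedAddCommGroup K] [NormedSpace ℂ K] {d : ℕ} (h : HasLogType A d) (T : A →L[ℂ] K)
    {C : ℝ} (hT : ∀ y, ∃ x, T x = y ∧ ‖x‖ ≤ C * ‖y‖) : HasLogType K d := by
  choose f hf hfC using hT
  refine h.transfer f (max ‖T‖ C) (fun x => (hfC x).trans ?_) fun r x ε => ?_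
  · gcongr; exact le_max_right _ _
  · calc _ = ‖T (∑ i, ε i • f (x i))‖ := by rw [map_sum_intUnits_smul]; simp only [hf]
      _ ≤ ‖T‖ * _ := T.le_opNorm _
      _ ≤ _ := by gcongr; exact le_max_left _ _

/-! ### Logarithmic type of extensions -/

/-- The sum, over the dyadic blocks of length `2 ^ l`, of the mean square of the signed block sum. -/
def blockSum {B : Type*} [SeminormedAddCommGroup B] : (r l : ℕ) → (DyadicIdx r → B) → ℝ
  | _, 0, b => ∑ i, ‖b i‖ ^ 2
  | 0, _ + 1, _ => 0
  | r + 1, l + 1, b => 𝔼 θ : DyadicIdx r → ℤˣ, blockSum r l (pairUp b θ)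

/-- Here p sends an index to its block. Padding each block with zeros keeps the index type fixed, so
that a type inequality on 2^r vectors applies to every block. Only an inequality can hold, since
`blockSum` is set to 0 when l exceeds r. -/
theorem blockSum_le_partition {B : Type*} [SeminormedAddCommGroup B] (r l : ℕ) :
    ∃ (J : Type) (_ : Fintype J) (_ : DecidableEq J) (p : DyadicIdx r → J),
      ∀ b : DyadicIdx r → B, blockSum r l b ≤ ∑ j, sqAvg fun i => if p i = j then b i else 0 := by
  induction l generalizing r with
  | zero =>
    refine ⟨DyadicIdx r, inferInstance, inferInstance, id, fun b => ?_⟩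
    rw [blockSum]
    refine sum_le_sum fun j _ => le_sqAvg_of_forall fun ε => le_of_eq ?_
    rw [sum_eq_single j (by simp +contextual) (by simp), id, if_pos rfl, norm_intUnits_smul]
  | succ l ih =>
    cases r with
    | zero =>
      exact ⟨Unit, inferInstance, inferInstance, fun _ => (), fun b => by
        rw [blockSum]; exact sum_nonneg fun _ _ => sqAvg_nonneg _⟩
    | succ r =>
      obtain ⟨J, hJ, hD, p, hp⟩ := ih r
      refine ⟨J, hJ, hD, fun q => p q.1, fun b => ?_⟩
      calc blockSum (r + 1) (l + 1) b
          ≤ 𝔼 θ : DyadicIdx r → ℤˣ, ∑ j, sqAvg fun i => if p i = j then pairUp b θ i else 0 := by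
            rw [blockSum]
            exact expect_le_expect fun θ _ => hp _
        _ = ∑ j, 𝔼 θ : DyadicIdx r → ℤˣ, sqAvg fun i => if p i = j then pairUp b θ i else 0 :=
            expect_sum_comm _ _ _
        _ = _ := by
            refine sum_congr rfl fun j _ => ?_
            refine Eq.trans ?_ (sqAvg_eq_expect_pairUp
              (fun q : DyadicIdx r × Bool => if p q.1 = j then b q else 0)).symm
            refine expect_congr rfl fun θ _ => congrArg sqAvg (funext fun i => ?_)
            simp only [pairUp]
            split_ifs <;> simp

/-- The blocks are disjoint, so the type inequalities of the single blocks add up with the same β at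
every level l. -/
theorem blockSum_le {B : Type*} [SeminormedAddCommGroup B] {r : ℕ} {β : ℝ}
    (h : ∀ b : DyadicIdx r → B, sqAvg b ≤ β * ∑ i, ‖b i‖ ^ 2) (l : ℕ) (b : DyadicIdx r → B) :
    blockSum r l b ≤ β * ∑ i, ‖b i‖ ^ 2 := by
  obtain ⟨J, _, _, p, hp⟩ := blockSum_le_partition (B := B) r l
  calc _ ≤ _ := hp b
    _ ≤ ∑ j, β * ∑ i, ‖if p i = j then b i else 0‖ ^ 2 := sum_le_sum fun j _ => h _
    _ = β * ∑ i, ∑ j, ‖if p i = j then b i else 0‖ ^ 2 := by rw [← mul_sum, sum_comm]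
    _ = _ := by
      congr 1
      refine sum_congr rfl fun i _ => ?_
      rw [sum_eq_single (p i) (fun j _ hj => by simp [hj.symm]) (by simp), if_pos rfl]

section Extension

variable {Z B : Type*} [NormedAddCommGroup Z] [NormedSpace ℂ Z] [NormedAddCommGroup B]
  [NormedSpace ℂ B] (π : Z →ₗ[ℂ] B)

/-- Replacing L(u) + θL(v) by L(u + θv) costs a kernel element of norm at most 2C(‖u‖ + ‖v‖). Its
average is controlled by a, and the induction continues with the 2^r paired vectors. Each level of
the tree contributes one `blockSum`. -/
theorem sqAvg_lift_le {R : ℕ} {a C : ℝ} (ha : 0 ≤ a) (hC : 0 ≤ C)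
    (hker : ∀ r ≤ R, ∀ x : DyadicIdx r → LinearMap.ker π, sqAvg x ≤ a * ∑ i, ‖x i‖ ^ 2)
    (L : B → Z) (hL : ∀ b, π (L b) = b) (hLC : ∀ b, ‖L b‖ ≤ C * ‖b‖) {r : ℕ} (hr : r ≤ R)
    (b : DyadicIdx r → B) :
    sqAvg (fun i => L (b i)) ≤
      C ^ 2 * (1 + 8 * a) * (r + 1) * ∑ l ∈ range (r + 1), blockSum r l b := by
  induction r with
  | zero =>
    refine sqAvg_le_of_forall fun ε => ?_
    simp only [zero_add, sum_range_one, blockSum, DyadicIdx.sum_zero, norm_intUnits_smul]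
    have h1 := pow_le_pow_left₀ (norm_nonneg _) (hLC (b .root)) 2
    have h2 : 0 ≤ (C * ‖b .root‖) ^ 2 * a := by positivity
    rw [mul_pow] at h1 h2
    push_cast
    nlinarith
  | succ r ih =>
    set K := C ^ 2 * (1 + 8 * a) with hK
    have hKa : 8 * C ^ 2 * a ≤ K := by rw [hK]; nlinarith [sq_nonneg C]
    have hK0 : 0 ≤ K := by positivity
    set S := ∑ q, ‖b q‖ ^ 2 with hS
    have hS0 : 0 ≤ S := sum_nonneg fun _ _ => by positivity
    have hr' : (0 : ℝ) < (r : ℝ) + 1 := by positivity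
    have key : ∀ θ : DyadicIdx r → ℤˣ, sqAvg (pairUp (fun q => L (b q)) θ) ≤
        K * (r + 2) * ∑ l ∈ range (r + 1), blockSum r l (pairUp b θ) + K * (r + 2) * S := by
      intro θ
      -- The failure of additivity of L on each signed pair, which π annihilates.
      let δ : DyadicIdx r → LinearMap.ker π := fun i =>
        ⟨pairUp (fun q => L (b q)) θ i - L (pairUp b θ i), by
          rw [LinearMap.mem_ker, map_sub, hL]
          simp only [pairUp, map_add, map_intUnits_smul, hL, sub_self]⟩
      have hδ : ∑ i, ‖δ i‖ ^ 2 ≤ 8 * C ^ 2 * S := by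
        have hb : S = ∑ i, (‖b (i, false)‖ ^ 2 + ‖b (i, true)‖ ^ 2) :=
          DyadicIdx.sum_succ fun q => ‖b q‖ ^ 2
        rw [hb, mul_sum]
        refine sum_le_sum fun i _ => ?_
        have h1 : ‖δ i‖ ≤ 2 * C * (‖b (i, false)‖ + ‖b (i, true)‖) := by
          have h2 : ‖pairUp b θ i‖ ≤ ‖b (i, false)‖ + ‖b (i, true)‖ := by
            refine (norm_add_le _ _).trans ?_
            rw [norm_intUnits_smul]
          have h3 : ‖pairUp (fun q => L (b q)) θ i‖ ≤ C * ‖b (i, false)‖ + C * ‖b (i, true)‖ := by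
            refine (norm_add_le _ _).trans ?_
            rw [norm_intUnits_smul]
            exact add_le_add (hLC _) (hLC _)
          have h4 := (hLC (pairUp b θ i)).trans (mul_le_mul_of_nonneg_left h2 hC)
          have h5 : ‖δ i‖ ≤ _ := norm_sub_le (pairUp (fun q => L (b q)) θ i) (L (pairUp b θ i))
          linarith
        have h6 := pow_le_pow_left₀ (norm_nonneg _) h1 2
        nlinarith [mul_nonneg (sq_nonneg C) (sq_nonneg (‖b (i, false)‖ - ‖b (i, true)‖))]
      have h1 : sqAvg (fun i => (δ i : Z)) ≤ K * S := by
        rw [sqAvg_coe]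
        calc _ ≤ a * ∑ i, ‖δ i‖ ^ 2 := hker r (by omega) δ
          _ ≤ a * (8 * C ^ 2 * S) := by gcongr
          _ = 8 * C ^ 2 * a * S := by ring
          _ ≤ _ := by gcongr
      -- With t = r + 1 both factors fit the induction: (1 + 1/t)(r + 1) = r + 2 and 1 + t = r + 2.
      have h2 := sqAvg_add_le (fun i => L (pairUp b θ i)) (fun i => (δ i : Z)) hr'
      have h3 : (fun i => L (pairUp b θ i) + (δ i : Z)) = pairUp (fun q => L (b q)) θ :=
        funext fun i => add_sub_cancel _ _
      rw [h3] at h2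
      calc _ ≤ _ := h2
        _ ≤ (1 + 1 / ((r : ℝ) + 1)) *
              (K * (r + 1) * ∑ l ∈ range (r + 1), blockSum r l (pairUp b θ))
            + (1 + ((r : ℝ) + 1)) * (K * S) := by
          gcongr
          exact ih (by omega) _
        _ = _ := by field_simp; ring
    calc sqAvg (fun q => L (b q))
        = 𝔼 θ : DyadicIdx r → ℤˣ, sqAvg (pairUp (fun q => L (b q)) θ) :=
          sqAvg_eq_expect_pairUp _
      _ ≤ 𝔼 θ : DyadicIdx r → ℤˣ, (K * (r + 2) * ∑ l ∈ range (r + 1), blockSum r l (pairUp b θ)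
            + K * (r + 2) * S) := expect_le_expect fun θ _ => key θ
      _ = K * (r + 2) * ∑ l ∈ range (r + 1), blockSum (r + 1) (l + 1) b + K * (r + 2) * S := by
          rw [expect_add_distrib, Fintype.expect_const, ← mul_expect, expect_sum_comm]
          simp only [blockSum]
      _ = _ := by
          rw [sum_range_succ' _ (r + 1), show blockSum (r + 1) 0 b = S by rw [blockSum]]
          push_cast; ring

/-- Logarithmic type of an extension. -/
theorem HasLogType.extension {d e : ℕ} (hA : HasLogType (LinearMap.ker π) d) (hB : HasLogType B e)
    {C D : ℝ} (hπ : ∀ z, ‖π z‖ ≤ D * ‖z‖) (hlift : ∀ b, ∃ z, π z = b ∧ ‖z‖ ≤ C * ‖b‖) :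
    HasLogType Z (d + e + 1) := by
  obtain ⟨a, ha, hA⟩ := hA
  obtain ⟨β, hβ, hB⟩ := hB
  choose L hL hLC using hlift
  wlog hC : 0 ≤ C generalizing C
  · exact this (C := 0) (fun b => (hLC b).trans
      (mul_le_mul_of_nonneg_right (not_le.1 hC).le (norm_nonneg _))) le_rfl
  refine ⟨2 * (2 * a * (1 + (C * D) ^ 2) * 1 + C ^ 2 * (1 + 8 * a) * β * D ^ 2), by positivity,
    fun r x => ?_⟩
  set ρ : ℝ := (r : ℝ) + 1 with hρ
  have hρ1 : 1 ≤ ρ := by simp [hρ]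
  set S := ∑ i, ‖x i‖ ^ 2 with hS
  have hS0 : 0 ≤ S := sum_nonneg fun _ _ => by positivity
  have hSπ : ∑ i, ‖π (x i)‖ ^ 2 ≤ D ^ 2 * S := by
    rw [hS, mul_sum]
    refine sum_le_sum fun i _ => ?_
    rw [← mul_pow]
    exact pow_le_pow_left₀ (norm_nonneg _) (hπ _) 2
  -- One factor ρ comes from the splitting constants and one from the r + 1 levels. Together they
  -- give ρ², a single extra logarithm in the type constant.
  have h1 : sqAvg (fun i => L (π (x i))) ≤
      C ^ 2 * (1 + 8 * (a * ρ ^ (2 * d))) * ρ * (ρ * (β * ρ ^ (2 * e) * (D ^ 2 * S))) := by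
    refine (sqAvg_lift_le π (R := r) (a := a * ρ ^ (2 * d)) (by positivity) hC
      (fun s hs y => (hA s y).trans ?_) L hL hLC le_rfl _).trans ?_
    · rw [hρ]; gcongr
    · refine mul_le_mul_of_nonneg_left ?_ (by positivity)
      calc _ ≤ ∑ l ∈ range (r + 1), β * ρ ^ (2 * e) * (D ^ 2 * S) :=
            sum_le_sum fun l _ => (blockSum_le (hB r) l _).trans (by gcongr)
        _ = _ := by simp [hρ]
  -- Split x = (x - Lπx) + Lπx: the first part lies in the kernel, the second is handled by the
  -- tree.
  let δ : DyadicIdx r → LinearMap.ker π := fun i =>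
    ⟨x i - L (π (x i)), by rw [LinearMap.mem_ker, map_sub, hL, sub_self]⟩
  have hδ : ∑ i, ‖δ i‖ ^ 2 ≤ 2 * (1 + (C * D) ^ 2) * S := by
    rw [hS, mul_sum]
    refine sum_le_sum fun i _ => ?_
    have h2 : ‖δ i‖ ≤ ‖x i‖ + C * D * ‖x i‖ := (norm_sub_le _ _).trans
      (add_le_add le_rfl (((hLC _).trans (mul_le_mul_of_nonneg_left (hπ _) hC)).trans_eq
        (mul_assoc _ _ _).symm))
    have h3 := pow_le_pow_left₀ (norm_nonneg _) h2 2
    nlinarith [sq_nonneg (‖x i‖ - C * D * ‖x i‖)]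
  have h2 : sqAvg (fun i => (δ i : Z)) ≤ a * ρ ^ (2 * d) * (2 * (1 + (C * D) ^ 2) * S) := by
    rw [sqAvg_coe]
    exact (hA r δ).trans (by gcongr)
  have h3 := sqAvg_add_le (fun i => (δ i : Z)) (fun i => L (π (x i))) one_pos
  simp only [show ∀ i, (δ i : Z) + L (π (x i)) = x i from fun i => sub_add_cancel _ _] at h3
  have h4 : ρ ^ (2 * d) ≤ ρ ^ (2 * (d + e + 1)) := pow_le_pow_right₀ hρ1 (by omega)
  have h5 : (1 : ℝ) ≤ ρ ^ (2 * d) := one_le_pow₀ hρ1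
  have h6 : ρ * ρ * ρ ^ (2 * e) * ρ ^ (2 * d) = ρ ^ (2 * (d + e + 1)) := by ring
  calc sqAvg x ≤ 2 * (a * ρ ^ (2 * d) * (2 * (1 + (C * D) ^ 2) * S)) + 2 *
        (C ^ 2 * (1 + 8 * (a * ρ ^ (2 * d))) * ρ * (ρ * (β * ρ ^ (2 * e) * (D ^ 2 * S)))) := by
        linarith
    _ ≤ 2 * (a * ρ ^ (2 * (d + e + 1)) * (2 * (1 + (C * D) ^ 2) * S)) + 2 *
        (C ^ 2 * (ρ ^ (2 * d) + 8 * (a * ρ ^ (2 * d))) * ρ *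
          (ρ * (β * ρ ^ (2 * e) * (D ^ 2 * S)))) := by gcongr
    _ = _ := by rw [← h6]; ring

end Extension

/-! ### Type of twisted Hilbert spaces -/

theorem IsTwistedHilbert.completeSpace.{u} {k : ℕ} {Z : Type u} [NormedAddCommGroup Z]
    [NormedSpace ℂ Z] (h : IsTwistedHilbert k Z) : CompleteSpace Z := by
  cases h <;> assumption

/-- The exponents match because (i - 1) + (j - 1) + 1 = i + j - 1. The open mapping theorem supplies
bounded lifts along π and identifies A with the kernel of π up to constants. -/
theorem IsTwistedHilbert.hasLogType.{u} {k : ℕ} {Z : Type u} [NormedAddCommGroup Z]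
    [NormedSpace ℂ Z] (h : IsTwistedHilbert k Z) : HasLogType Z (k - 1) := by
  induction h with
  | hilbert Z H e =>
    exact (hasLogType_of_inner H).of_lift (e.symm : H →L[ℂ] Z) (C := ‖(e : Z →L[ℂ] H)‖)
      fun z => ⟨e z, e.symm_apply_apply z, (e : Z →L[ℂ] H).le_opNorm z⟩
  | twist i j A Z B hi hj hA hB ι π h_inj h_exact h_surj ihA ihB =>
    have := hA.completeSpace
    have := hB.completeSpace
    obtain ⟨C, _, hC⟩ := π.exists_preimage_norm_le h_surj
    have hι : ∀ a, ι a ∈ LinearMap.ker (π : Z →ₗ[ℂ] B) := fun a => (h_exact _).2 ⟨a, rfl⟩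
    let T : A →L[ℂ] LinearMap.ker (π : Z →ₗ[ℂ] B) := ι.codRestrict _ hι
    have hT : Function.Surjective T := fun z => by
      obtain ⟨a, ha⟩ := (h_exact _).1 z.2
      exact ⟨a, Subtype.ext ha⟩
    have : CompleteSpace (LinearMap.ker (π : Z →ₗ[ℂ] B)) := π.isClosed_ker.completeSpace_coe
    obtain ⟨D, _, hD⟩ := T.exists_preimage_norm_le hT
    have h := HasLogType.extension (π : Z →ₗ[ℂ] B) (ihA.of_lift T hD) ihB π.le_opNorm hC
    rwa [show i - 1 + (j - 1) + 1 = i + j - 1 by omega] at h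

/-! ### Exponential functions in the Calderón space and values at 1/2 -/

/-- The coordinate functional on `ℓ_p`. -/
def lpCoord (p : ℝ≥0∞) [Fact (1 ≤ p)] (n : ℕ) : lp (fun _ : ℕ => ℂ) p →L[ℂ] ℂ :=
  LinearMap.mkContinuous
    { toFun := fun x => x n
      map_add' := fun _ _ => rfl
      map_smul' := fun _ _ => rfl } 1 fun x => by
    rw [one_mul]
    exact lp.norm_apply_le_norm (zero_lt_one.trans_le Fact.out).ne' x n

theorem lpCoord_apply (p : ℝ≥0∞) [Fact (1 ≤ p)] (n : ℕ) (x : lp (fun _ : ℕ => ℂ) p) :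
    lpCoord p n x = x n := rfl

theorem openStrip_subset : openStrip ⊆ closedStrip := fun _ hz => ⟨hz.1.le, hz.2.le⟩

theorem norm_mul_cexp (c z : ℂ) (d : ℝ) : ‖c * Complex.exp (z * d)‖ = ‖c‖ * Real.exp (z.re * d) := by
  rw [norm_mul, Complex.norm_exp, Complex.re_mul_ofReal]

theorem norm_mul_cexp_le (c : ℂ) (d : ℝ) {z : ℂ} (hz : z ∈ closedStrip) :
    ‖c * Complex.exp (z * d)‖ ≤ max ‖c‖ (‖c‖ * Real.exp d) := by
  rw [norm_mul_cexp]
  rcases le_total d 0 with hd | hd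
  · refine le_max_of_le_left (mul_le_of_le_one_right (norm_nonneg _) (Real.exp_le_one_iff.2 ?_))
    exact mul_nonpos_of_nonneg_of_nonpos hz.1 hd
  · refine le_max_of_le_right ?_
    gcongr
    exact mul_le_of_le_one_left hd hz.2

namespace CalderonSpace

theorem leftPt_re (t : ℝ) : (leftPt t).re = 0 := by simp [leftPt]

theorem rightPt_re (t : ℝ) : (rightPt t).re = 1 := by simp [rightPt]

theorem continuous_rightPt : Continuous rightPt := by unfold rightPt; fun_prop

/-- A function in the Calderón space all of whose coordinates are exponentials. -/
theorem exists_exp (c : ℕ → ℂ) (d : ℕ → ℝ) {M : ℝ} (hc : Tendsto c atTop (𝓝 0))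
    (hcM : ∀ n, ‖c n‖ ≤ M) (hs : Summable fun n => ‖c n‖ * Real.exp (d n))
    (hsM : ∑' n, ‖c n‖ * Real.exp (d n) ≤ M) :
    ∃ f : CalderonSpace, (∀ z ∈ closedStrip, ∀ n, f z n = c n * Complex.exp (z * d n)) ∧
      ‖f‖ ≤ M := by
  classical
  have hM : 0 ≤ M := (norm_nonneg _).trans (hcM 0)
  set τ : ℕ → ℝ := fun n => max ‖c n‖ (‖c n‖ * Real.exp (d n)) with hτ
  have hτ0 : Tendsto τ atTop (𝓝 0) := by
    simpa using (tendsto_zero_iff_norm_tendsto_zero.1 hc).max hs.tendsto_atTop_zero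
  have hτM : ∀ n, τ n ≤ M := fun n => max_le (hcM n) ((hs.le_tsum n fun _ _ => by positivity).trans hsM)
  have hτz : ∀ z ∈ closedStrip, ∀ n, ‖c n * Complex.exp (z * d n)‖ ≤ τ n :=
    fun z hz n => norm_mul_cexp_le _ _ hz
  have hmem : ∀ z : ℂ, Memℓp
      (fun n => if z ∈ closedStrip then c n * Complex.exp (z * d n) else 0 : ℕ → ℂ) ∞ := fun z => by
    refine memℓp_infty ⟨M, ?_⟩
    rintro _ ⟨n, rfl⟩
    dsimp only
    split_ifs with hz
    · exact (hτz z hz n).trans (hτM n)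
    · simpa using hM
  let f : ℂ → EllInfty := fun z => ⟨_, hmem z⟩
  have hf : ∀ z ∈ closedStrip, ∀ n, f z n = c n * Complex.exp (z * d n) := fun z hz n => by
    change (if z ∈ closedStrip then c n * Complex.exp (z * d n) else 0 : ℂ) = _
    rw [if_pos hz]
  let F : ℕ → ℂ → EllInfty := fun N z =>
    ∑ n ∈ range N, lp.single ∞ n (c n * Complex.exp (z * d n))
  have hFd : ∀ N, Differentiable ℂ (F N) := fun N => by
    refine Differentiable.fun_sum fun n _ => ?_
    have h : ∀ z : ℂ, (lp.single ∞ n (c n * Complex.exp (z * d n)) : EllInfty) =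
        (c n * Complex.exp (z * d n)) • lp.single ∞ n (1 : ℂ) := fun z => by
      rw [← lp.single_smul, smul_eq_mul, mul_one]
    simp only [h]
    fun_prop
  have hFn : ∀ N z n, F N z n = if n < N then c n * Complex.exp (z * d n) else 0 := fun N z n => by
    simp only [F, lp.coeFn_sum, Finset.sum_apply, lp.single_apply, Finset.sum_pi_single, mem_range]
  -- The bounds τ n do not depend on z and tend to 0, so the truncations converge uniformly in ℓ_∞;
  -- continuity and analyticity pass to the limit.
  have hunif : TendstoUniformlyOn F f atTop closedStrip := by
    rw [Metric.tendstoUniformlyOn_iff]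
    intro ε hε
    obtain ⟨N₀, hN₀⟩ := eventually_atTop.1 (hτ0.eventually (gt_mem_nhds (half_pos hε)))
    filter_upwards [eventually_ge_atTop N₀] with N hN z hz
    rw [dist_eq_norm]
    refine lt_of_le_of_lt (lp.norm_le_of_forall_le (half_pos hε).le fun n => ?_) (half_lt_self hε)
    rw [lp.coeFn_sub, Pi.sub_apply, hf z hz, hFn]
    split_ifs with h
    · simpa using (half_pos hε).le
    · rw [sub_zero]
      exact (hτz z hz n).trans (hN₀ n (by omega)).le
  have hsingle : ∀ (t : ℝ) (n : ℕ),
      ‖(lp.single 1 n (c n * Complex.exp (rightPt t * d n)) : EllOne)‖ = ‖c n‖ * Real.exp (d n) :=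
    fun t n => by rw [lp.norm_single one_pos, norm_mul_cexp, rightPt_re, one_mul]
  have hcont : ∀ n, Continuous fun t : ℝ =>
      (lp.single 1 n (c n * Complex.exp (rightPt t * d n)) : EllOne) := fun n =>
    (lp.isometry_single n).continuous.comp (by have := continuous_rightPt; fun_prop)
  let g : ℝ → EllOne := fun t => ∑' n, lp.single 1 n (c n * Complex.exp (rightPt t * d n))
  have hg : Continuous g := continuous_tsum hcont hs fun n t => (hsingle t n).le
  have hgn : ∀ t n, g t n = c n * Complex.exp (rightPt t * d n) := fun t n => by
    have h1 : Summable fun k => (lp.single 1 k (c k * Complex.exp (rightPt t * d k)) : EllOne) :=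
      Summable.of_norm (by simpa only [hsingle] using hs)
    rw [← lpCoord_apply 1 n (g t), (lpCoord 1 n).map_tsum h1,
      tsum_eq_single n fun k hk => by rw [lpCoord_apply, lp.single_apply_ne _ _ _ hk.symm],
      lpCoord_apply, lp.single_apply_self]
  have hgM : ∀ t, ‖g t‖ ≤ M := fun t => by
    refine le_trans (tsum_of_norm_bounded hs.hasSum fun n => (hsingle t n).le) hsM
  have hfM : ∀ z ∈ closedStrip, ‖f z‖ ≤ M := fun z hz =>
    lp.norm_le_of_forall_le hM fun n => by
      rw [hf z hz]; exact (hτz z hz n).trans (hτM n)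
  have hfC : IsCalderon f :=
    { zero_off := fun z hz => lp.ext (funext fun n => if_neg hz)
      continuousOn := hunif.continuousOn
        (Frequently.of_forall fun N => (hFd N).continuous.continuousOn)
      differentiableOn := (hunif.mono openStrip_subset).tendstoLocallyUniformlyOn.differentiableOn
        (Eventually.of_forall fun N => (hFd N).differentiableOn) isOpen_openStrip
      bounded := ⟨M, hfM⟩
      trace := ⟨BoundedContinuousFunction.ofNormedAddCommGroup g hg M hgM, fun t n => by
        rw [hf _ (rightPt_mem t)]; exact hgn t n⟩ }
  refine ⟨⟨f, hfC⟩, hf, norm_le (fun t => hfM _ (leftPt_mem t)) fun t => ?_⟩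
  refine le_trans (le_of_eq (tsum_congr fun n => ?_)) hsM
  change ‖f (rightPt t) n‖ = _
  rw [hf _ (rightPt_mem t), norm_mul_cexp, rightPt_re, one_mul]

/-- Three lines theorem against finite families of exponentials. -/
theorem norm_sum_exp_le (f : CalderonSpace) {ι : Type*} (s : Finset ι) (φ : ι → ℕ)
    (hφ : Function.Injective φ) (c : ι → ℂ) (d : ι → ℝ) {M : ℝ} (h0 : ∑ i ∈ s, ‖c i‖ ≤ M)
    (h1 : ∀ i ∈ s, ‖c i‖ * Real.exp (d i) ≤ M) {z : ℂ} (hz : z ∈ closedStrip) :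
    ‖∑ i ∈ s, f z (φ i) * (c i * Complex.exp (z * d i))‖ ≤ M * ‖f‖ := by
  have hM : 0 ≤ M := (sum_nonneg fun _ _ => norm_nonneg _).trans h0
  have hcl : closure (Complex.re ⁻¹' Set.Ioo (0 : ℝ) 1) = closedStrip := by
    rw [Complex.closure_preimage_re, closure_Ioo zero_ne_one]; rfl
  have hfn : ∀ {z : ℂ}, z ∈ closedStrip → ∀ n, ‖f z n‖ ≤ ‖f‖ := fun hz n =>
    (lp.norm_apply_le_norm ENNReal.top_ne_zero _ n).trans (norm_le_of_mem f hz)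
  refine PhragmenLindelof.vertical_strip (a := 0) (b := 1)
    (f := fun z => ∑ i ∈ s, f z (φ i) * (c i * Complex.exp (z * d i))) ⟨?_, ?_⟩ ?_ ?_ ?_ hz.1 hz.2
  · refine DifferentiableOn.fun_sum fun i _ => DifferentiableOn.mul ?_ (by fun_prop)
    exact (lpCoord ∞ (φ i)).differentiable.comp_differentiableOn f.isCalderon.differentiableOn
  · rw [hcl]
    refine continuousOn_finsetSum _ fun i _ => ContinuousOn.mul ?_ (by fun_prop)
    exact (lpCoord ∞ (φ i)).continuous.comp_continuousOn f.isCalderon.continuousOn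
  · refine ⟨0, by simpa using Real.pi_pos, 0, ?_⟩
    refine Asymptotics.IsBigO.of_bound
      (∑ i ∈ s, ‖f‖ * max ‖c i‖ (‖c i‖ * Real.exp (d i))) ?_
    rw [Filter.eventually_inf_principal]
    refine Filter.Eventually.of_forall fun w hw => ?_
    have hw' : w ∈ closedStrip := ⟨hw.1.le, hw.2.le⟩
    simp only [zero_mul, Real.exp_zero, norm_one, mul_one]
    refine (norm_sum_le _ _).trans (sum_le_sum fun i _ => ?_)
    rw [norm_mul]
    gcongr
    · exact hfn hw' _
    · exact norm_mul_cexp_le _ _ hw'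
  · intro w hw
    have hw' : w ∈ closedStrip := ⟨hw.ge, hw.le.trans zero_le_one⟩
    calc _ ≤ ∑ i ∈ s, ‖f w (φ i) * (c i * Complex.exp (w * d i))‖ := norm_sum_le _ _
      _ ≤ ∑ i ∈ s, ‖f‖ * ‖c i‖ := sum_le_sum fun i _ => by
          rw [norm_mul, norm_mul_cexp, hw, zero_mul, Real.exp_zero, mul_one]
          gcongr
          exact hfn hw' _
      _ = (∑ i ∈ s, ‖c i‖) * ‖f‖ := by rw [← mul_sum, mul_comm]
      _ ≤ _ := by gcongr
  · intro w hw
    have hwt : w = rightPt w.im := by apply Complex.ext <;> simp [rightPt, hw]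
    calc _ ≤ ∑ i ∈ s, ‖f w (φ i) * (c i * Complex.exp (w * d i))‖ := norm_sum_le _ _
      _ ≤ ∑ i ∈ s, M * ‖f w (φ i)‖ := sum_le_sum fun i hi => by
          rw [norm_mul, norm_mul_cexp, hw, one_mul, mul_comm]
          gcongr
          exact h1 i hi
      _ = M * ∑ n ∈ s.map ⟨φ, hφ⟩, ‖f w n‖ := by rw [← mul_sum, sum_map]; rfl
      _ ≤ _ := by
          gcongr
          rw [hwt]
          exact ((summable_right f _).sum_le_tsum _ fun _ _ => norm_nonneg _).trans (right_le f _)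

/-- Duality with the extremal family conj(w_n)(‖w_n‖/ρ)^(1-2z). Its ℓ_1 norm on Re z = 0 and its sup
norm on Re z = 1 are at most ρ, while at 1/2 the pairing equals S = ρ². Thus ρ² ≤ ρ‖f‖. -/
theorem sum_sq_half_le (f : CalderonSpace) (s : Finset ℕ) :
    ∑ n ∈ s, ‖f (1 / 2) n‖ ^ 2 ≤ ‖f‖ ^ 2 := by
  set w : ℕ → ℂ := fun n => f (1 / 2) n with hw
  set S := ∑ n ∈ s, ‖w n‖ ^ 2 with hS
  have hS0 : 0 ≤ S := sum_nonneg fun _ _ => by positivity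
  rcases hS0.eq_or_lt with h | hpos
  · rw [← h]; positivity
  set ρ := √S with hρ
  have hρ0 : 0 < ρ := Real.sqrt_pos.2 hpos
  have hρ2 : ρ ^ 2 = S := Real.sq_sqrt hS0
  have key := norm_sum_exp_le f s id Function.injective_id
    (fun n => star (w n) * (‖w n‖ / ρ : ℝ)) (fun n => -2 * Real.log (‖w n‖ / ρ)) (M := ρ) ?_ ?_
    (openStrip_subset half_mem)
  · have hsum : ∑ n ∈ s, f (1 / 2) (id n) * (star (w n) * (‖w n‖ / ρ : ℝ) *
        Complex.exp (1 / 2 * (-2 * Real.log (‖w n‖ / ρ) : ℝ))) = (S : ℂ) := by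
      rw [hS, Complex.ofReal_sum]
      refine sum_congr rfl fun n _ => ?_
      rcases eq_or_ne (w n) 0 with h0 | h0
      · simp [h0]
      · have hq : 0 < ‖w n‖ / ρ := div_pos (norm_pos_iff.2 h0) hρ0
        have h2 : Complex.exp (1 / 2 * (-2 * Real.log (‖w n‖ / ρ) : ℝ)) = ((‖w n‖ / ρ : ℝ) : ℂ)⁻¹ := by
          rw [show (1 / 2 : ℂ) * (-2 * Real.log (‖w n‖ / ρ) : ℝ) = ((-Real.log (‖w n‖ / ρ) : ℝ) : ℂ) by
            push_cast; ring, ← Complex.ofReal_exp, Real.exp_neg, Real.exp_log hq, Complex.ofReal_inv]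
        rw [h2, mul_assoc, mul_inv_cancel₀ (by exact_mod_cast hq.ne'), mul_one]
        change w n * star (w n) = _
        rw [Complex.star_def, Complex.mul_conj, Complex.normSq_eq_norm_sq]
    rw [hsum, Complex.norm_real, Real.norm_of_nonneg hS0, ← hρ2, sq] at key
    have := le_of_mul_le_mul_left key hρ0
    rw [← hρ2]
    gcongr
  · have h : ∀ n, ‖star (w n) * (‖w n‖ / ρ : ℝ)‖ = ‖w n‖ ^ 2 / ρ := fun n => by
      rw [norm_mul, norm_star, Complex.norm_real, Real.norm_of_nonneg (by positivity)]; ring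
    simp only [h]
    rw [← sum_div, ← hS, ← hρ2, sq, mul_div_cancel_right₀ _ hρ0.ne']
  · intro n _
    rcases eq_or_ne (w n) 0 with h0 | h0
    · simp [h0, hρ0.le]
    · have hq : 0 < ‖w n‖ / ρ := div_pos (norm_pos_iff.2 h0) hρ0
      have h1 : 0 < ‖w n‖ := norm_pos_iff.2 h0
      rw [norm_mul, norm_star, Complex.norm_real, Real.norm_of_nonneg hq.le, neg_mul, Real.exp_neg,
        two_mul, Real.exp_add, Real.exp_log hq]
      apply le_of_eq
      field_simp

/-- Every element of `ℓ_2` is the value at `1/2` of a function in the Calderón space. -/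
theorem exists_half_eq (w : lp (fun _ : ℕ => ℂ) 2) :
    ∃ f : CalderonSpace, (∀ n, f (1 / 2) n = w n) ∧ ‖f‖ ≤ 2 * ‖w‖ := by
  have h2 : (0 : ℝ) < (2 : ℝ≥0∞).toReal := by norm_num
  have hsum : HasSum (fun n => ‖w n‖ ^ 2) (‖w‖ ^ 2) := by
    simpa using lp.hasSum_norm h2 w
  -- The usual extremal w|w|^(2z-1) does not decay in n relative to ‖w‖ on Re z = 0, which endangers
  -- norm continuity there. Dividing by the square root of the tail instead of by ‖w‖ makes the
  -- coordinates at Re z = 0 at most √(R n), which tends to 0.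
  set R : ℕ → ℝ := fun n => ∑' k, ‖w (k + n)‖ ^ 2 with hR
  have hR0 : R 0 = ‖w‖ ^ 2 := by simpa [hR] using hsum.tsum_eq
  have hRs : ∀ n, R n = ‖w n‖ ^ 2 + R (n + 1) := fun n => by
    have h := ((summable_nat_add_iff n).2 hsum.summable).tsum_eq_zero_add
    simp only [zero_add] at h
    rw [hR]
    dsimp only
    rw [h]
    congr 1
    exact tsum_congr fun k => by rw [add_right_comm, add_assoc]
  have hRnn : ∀ n, 0 ≤ R n := fun n => tsum_nonneg fun _ => by positivity
  have hRlim : Tendsto R atTop (𝓝 0) := tendsto_sum_nat_add fun n => ‖w n‖ ^ 2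
  have hRanti : ∀ n, R n ≤ R 0 := fun n => by
    induction n with
    | zero => exact le_rfl
    | succ n ih => exact le_trans (by rw [hRs n]; nlinarith [norm_nonneg (w n)]) ih
  set v : ℕ → ℝ := fun n => ‖w n‖ / √(R n) with hv
  have hpos : ∀ n, w n ≠ 0 → 0 < ‖w n‖ ∧ 0 < √(R n) ∧ 0 < v n := fun n hn => by
    have h1 := norm_pos_iff.2 hn
    have h3 : 0 < √(R n) := Real.sqrt_pos.2 (by rw [hRs n]; have := hRnn (n + 1); positivity)
    exact ⟨h1, h3, div_pos h1 h3⟩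
  have hc : ∀ n, ‖w n / (v n : ℂ)‖ ≤ √(R n) := fun n => by
    rcases eq_or_ne (w n) 0 with h0 | h0
    · simp [h0]
    · obtain ⟨h1, h3, h4⟩ := hpos n h0
      rw [norm_div, Complex.norm_real, Real.norm_of_nonneg h4.le, hv]
      apply le_of_eq
      field_simp
  -- On Re z = 1 the n-th coordinate has size ‖w n‖²/√(R n), and ‖w n‖² = R n - R (n + 1) is a
  -- difference of squares; the resulting bound telescopes.
  have hterm : ∀ n, ‖w n / (v n : ℂ)‖ * Real.exp (2 * Real.log (v n)) ≤
      2 * √(R n) - 2 * √(R (n + 1)) := fun n => by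
    have h5 : √(R (n + 1)) ≤ √(R n) := Real.sqrt_le_sqrt (by rw [hRs n]; nlinarith [norm_nonneg (w n)])
    rcases eq_or_ne (w n) 0 with h0 | h0
    · simp [h0, h5]
    · obtain ⟨h1, h3, h4⟩ := hpos n h0
      rw [norm_div, Complex.norm_real, Real.norm_of_nonneg h4.le, two_mul (Real.log _),
        Real.exp_add, Real.exp_log h4]
      have h6 : ‖w n‖ / v n * (v n * v n) = ‖w n‖ ^ 2 / √(R n) := by
        rw [hv]; field_simp
      rw [h6, div_le_iff₀ h3]
      have h7 := Real.sq_sqrt (hRnn n)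
      have h8 := Real.sq_sqrt (hRnn (n + 1))
      have h9 := hRs n
      nlinarith [Real.sqrt_nonneg (R (n + 1))]
  have hrange : ∀ N, ∑ n ∈ range N, ‖w n / (v n : ℂ)‖ * Real.exp (2 * Real.log (v n)) ≤ 2 * ‖w‖ :=
    fun N => by
    calc _ ≤ ∑ n ∈ range N, (2 * √(R n) - 2 * √(R (n + 1))) := sum_le_sum fun n _ => hterm n
      _ = 2 * √(R 0) - 2 * √(R N) := sum_range_sub' (fun n => 2 * √(R n)) N
      _ ≤ 2 * ‖w‖ := by
        rw [hR0, Real.sqrt_sq (norm_nonneg _)]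
        linarith [Real.sqrt_nonneg (R N)]
  obtain ⟨f, hf, hfM⟩ := exists_exp (fun n => w n / (v n : ℂ)) (fun n => 2 * Real.log (v n))
    (M := 2 * ‖w‖)
    (squeeze_zero_norm hc (by simpa using hRlim.sqrt))
    (fun n => (hc n).trans (by
      have h := Real.sqrt_le_sqrt (hRanti n)
      rw [hR0, Real.sqrt_sq (norm_nonneg _)] at h
      linarith [norm_nonneg w]))
    (summable_of_sum_range_le (fun n => by positivity) hrange)
    (Real.tsum_le_of_sum_range_le (fun n => by positivity) hrange)
  refine ⟨f, fun n => ?_, hfM⟩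
  rw [hf _ (openStrip_subset half_mem)]
  rcases eq_or_ne (w n) 0 with h0 | h0
  · simp [h0]
  · obtain ⟨h1, h3, h4⟩ := hpos n h0
    rw [show (1 / 2 : ℂ) * (2 * Real.log (v n) : ℝ) = (Real.log (v n) : ℂ) by push_cast; ring,
      ← Complex.ofReal_exp, Real.exp_log h4, div_mul_cancel₀ _ (by exact_mod_cast h4.ne')]

/-! ### Multiplication and division by a factor with a simple zero at 1/2 -/

/-- A function whose boundary values are bounded scalar multiples of those of `f`. -/
theorem exists_of_boundary_smul (f : CalderonSpace) (g : ℂ → EllInfty) (q : ℂ → ℂ) {K : ℝ}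
    (hg0 : ∀ z, z ∉ closedStrip → g z = 0) (hgc : ContinuousOn g closedStrip)
    (hgd : DifferentiableOn ℂ g openStrip) (hgb : ∃ C : ℝ, ∀ z ∈ closedStrip, ‖g z‖ ≤ C)
    (hql : ∀ t, g (leftPt t) = q (leftPt t) • f (leftPt t))
    (hqr : ∀ t, g (rightPt t) = q (rightPt t) • f (rightPt t))
    (hqc : Continuous fun t => q (rightPt t)) (hKl : ∀ t, ‖q (leftPt t)‖ ≤ K)
    (hKr : ∀ t, ‖q (rightPt t)‖ ≤ K) :
    ∃ h : CalderonSpace, (h : ℂ → EllInfty) = g ∧ ‖h‖ ≤ K * ‖f‖ := by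
  have hK : 0 ≤ K := (norm_nonneg _).trans (hKl 0)
  obtain ⟨u, hu⟩ := f.isCalderon.trace
  have hg : IsCalderon g := ⟨hg0, hgc, hgd, hgb,
    BoundedContinuousFunction.ofNormedAddCommGroup (fun t => q (rightPt t) • u t)
      (hqc.smul u.continuous) (K * ‖u‖) fun t => by
        rw [norm_smul]
        exact mul_le_mul (hKr t) (u.norm_coe_le_norm t) (norm_nonneg _) hK,
    fun t n => by
      rw [hqr]
      change q (rightPt t) * u t n = q (rightPt t) * f (rightPt t) n
      rw [hu]⟩
  refine ⟨⟨g, hg⟩, rfl, norm_le (fun t => ?_) fun t => ?_⟩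
  · change ‖g (leftPt t)‖ ≤ _
    rw [hql, norm_smul]
    exact mul_le_mul (hKl t) (left_le f t) (norm_nonneg _) hK
  · change ∑' n, ‖g (rightPt t) n‖ ≤ _
    have h : ∀ n, ‖g (rightPt t) n‖ = ‖q (rightPt t)‖ * ‖f (rightPt t) n‖ := fun n => by
      rw [hqr, lp.coeFn_smul, Pi.smul_apply, norm_smul]
    simp only [h, tsum_mul_left]
    exact mul_le_mul (hKr t) (right_le f t) (tsum_nonneg fun _ => norm_nonneg _) hK

end CalderonSpace

theorem closedBall_half_subset : Metric.closedBall (1 / 2 : ℂ) (1 / 4) ⊆ openStrip := by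
  intro z hz
  rw [Metric.mem_closedBall, dist_eq_norm] at hz
  have h := abs_le.1 ((Complex.abs_re_le_norm _).trans hz)
  have h2 : (z - 1 / 2).re = z.re - 1 / 2 := by norm_num
  rw [h2] at h
  constructor <;> linarith [h.1, h.2]

/-- A bounded function on the strip with a simple zero at `1/2`. -/
def blaschke (z : ℂ) : ℂ := (z - 1 / 2) / (z + 1 / 2)

theorem add_half_ne_zero {z : ℂ} (hz : 0 ≤ z.re) : z + 1 / 2 ≠ 0 := fun h => by
  have h1 := congrArg Complex.re h
  have h2 : (z + 1 / 2).re = z.re + 1 / 2 := by norm_num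
  rw [h2, Complex.zero_re] at h1
  linarith

theorem sq_norm_add_half (z : ℂ) : ‖z + 1 / 2‖ ^ 2 = (z.re + 1 / 2) ^ 2 + z.im ^ 2 := by
  rw [← Complex.normSq_eq_norm_sq, Complex.normSq_apply]
  norm_num; ring

theorem sq_norm_sub_half (z : ℂ) : ‖z - 1 / 2‖ ^ 2 = (z.re - 1 / 2) ^ 2 + z.im ^ 2 := by
  rw [← Complex.normSq_eq_norm_sq, Complex.normSq_apply]
  norm_num; ring

theorem norm_blaschke_le {z : ℂ} (hz : z ∈ closedStrip) : ‖blaschke z‖ ≤ 1 := by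
  rw [blaschke, norm_div]
  refine div_le_one_of_le₀ (abs_le_of_sq_le_sq' ?_ (norm_nonneg _)).2 (norm_nonneg _)
  rw [sq_norm_add_half, sq_norm_sub_half]
  nlinarith [hz.1]

theorem differentiableOn_blaschke : DifferentiableOn ℂ blaschke closedStrip := by
  unfold blaschke
  exact DifferentiableOn.div (by fun_prop) (by fun_prop) fun z hz => add_half_ne_zero hz.1

theorem blaschke_half : blaschke (1 / 2) = 0 := by simp [blaschke]

theorem analyticAt_blaschke : AnalyticAt ℂ blaschke (1 / 2) :=
  (differentiableOn_blaschke.mono openStrip_subset).analyticAt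
    (CalderonSpace.isOpen_openStrip.mem_nhds CalderonSpace.half_mem)

namespace CalderonSpace

theorem exists_blaschke_smul (g : CalderonSpace) :
    ∃ h : CalderonSpace, (h : ℂ → EllInfty) = (fun z => blaschke z • g z) ∧ ‖h‖ ≤ 1 * ‖g‖ :=
  exists_of_boundary_smul g _ blaschke
    (fun z hz => by rw [g.isCalderon.zero_off z hz, smul_zero])
    (differentiableOn_blaschke.continuousOn.smul g.isCalderon.continuousOn)
    ((differentiableOn_blaschke.mono openStrip_subset).smul g.isCalderon.differentiableOn)
    ⟨1 * ‖g‖, fun z hz => by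
      rw [norm_smul]
      exact mul_le_mul (norm_blaschke_le hz) (norm_le_of_mem g hz) (norm_nonneg _) zero_le_one⟩
    (fun _ => rfl) (fun _ => rfl)
    (differentiableOn_blaschke.continuousOn.comp_continuous continuous_rightPt rightPt_mem)
    (fun t => norm_blaschke_le (leftPt_mem t)) (fun t => norm_blaschke_le (rightPt_mem t))

/-- Multiplication by `blaschke` on the Calderón space. -/
def blaschkeMul : CalderonSpace →ₗ[ℂ] CalderonSpace where
  toFun g := (exists_blaschke_smul g).choose
  map_add' f g := Subtype.ext <| by
    change _ = ((exists_blaschke_smul f).choose : ℂ → EllInfty) + (exists_blaschke_smul g).choose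
    rw [(exists_blaschke_smul f).choose_spec.1, (exists_blaschke_smul g).choose_spec.1]
    refine (exists_blaschke_smul (f + g)).choose_spec.1.trans (funext fun z => ?_)
    rw [add_apply, smul_add]; rfl
  map_smul' c g := Subtype.ext <| by
    change _ = c • ((exists_blaschke_smul g).choose : ℂ → EllInfty)
    rw [(exists_blaschke_smul g).choose_spec.1]
    refine (exists_blaschke_smul (c • g)).choose_spec.1.trans (funext fun z => ?_)
    rw [smul_apply, smul_comm]; rfl

theorem coe_blaschkeMul (g : CalderonSpace) :
    (blaschkeMul g : ℂ → EllInfty) = fun z => blaschke z • g z :=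
  (exists_blaschke_smul g).choose_spec.1

theorem norm_blaschkeMul_le (g : CalderonSpace) : ‖blaschkeMul g‖ ≤ ‖g‖ :=
  (exists_blaschke_smul g).choose_spec.2.trans (one_mul _).le

/-- Division by `blaschke` of a function vanishing at `1/2`. -/
theorem exists_blaschkeMul_eq (f : CalderonSpace) (hf : f (1 / 2) = 0) :
    ∃ h : CalderonSpace, blaschkeMul h = f ∧ ‖h‖ ≤ 3 * ‖f‖ := by
  have hnhds : openStrip ∈ 𝓝 (1 / 2 : ℂ) := isOpen_openStrip.mem_nhds half_mem
  have hnhds' : closedStrip ∈ 𝓝 (1 / 2 : ℂ) := mem_of_superset hnhds openStrip_subset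
  -- The quotient of f by `blaschke`, with the singularity at 1/2 removed by `dslope`.
  set g : ℂ → EllInfty := fun z => (z + 1 / 2) • dslope f (1 / 2) z with hg
  have hgz : ∀ z, z ≠ 1 / 2 → g z = ((z + 1 / 2) / (z - 1 / 2)) • f z := fun z hz => by
    rw [hg]
    dsimp only
    rw [dslope_of_ne _ hz, slope_def_module, hf, sub_zero, smul_smul, ← div_eq_mul_inv]
  have hne : ∀ z : ℂ, z.re ≠ 1 / 2 → z ≠ 1 / 2 := fun z hz h => hz (by rw [h]; norm_num)
  -- The quotient has modulus 1 on Re z = 0; on Re z = 1 it is largest at z = 1, with value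
  -- (3/2)/(1/2) = 3.
  have hle : ∀ z : ℂ, z.re = 0 ∨ z.re = 1 → ‖(z + 1 / 2) / (z - 1 / 2)‖ ≤ 3 := fun z hz => by
    have hz' : z ≠ 1 / 2 := hne z (by rcases hz with h | h <;> rw [h] <;> norm_num)
    rw [norm_div, div_le_iff₀ (norm_pos_iff.2 (sub_ne_zero.2 hz'))]
    refine (abs_le_of_sq_le_sq' ?_ (by positivity)).2
    rw [mul_pow, sq_norm_add_half, sq_norm_sub_half]
    rcases hz with h | h <;> rw [h] <;> nlinarith [sq_nonneg z.im]
  have hgc : ContinuousOn g closedStrip := by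
    refine (continuousOn_id.add continuousOn_const).smul ((continuousOn_dslope hnhds').2
      ⟨f.isCalderon.continuousOn, f.isCalderon.differentiableOn.differentiableAt hnhds⟩)
  obtain ⟨h, hh, hn⟩ := exists_of_boundary_smul f g (fun z => (z + 1 / 2) / (z - 1 / 2)) (K := 3)
    (fun z hz => by
      rw [hgz z fun h => hz (h ▸ openStrip_subset half_mem), f.isCalderon.zero_off z hz, smul_zero])
    hgc
    ((differentiableOn_id.add_const _).smul
      ((Complex.differentiableOn_dslope hnhds).2 f.isCalderon.differentiableOn))
    (by
      obtain ⟨C, hC⟩ := (isCompact_closedBall (1 / 2 : ℂ) (1 / 4)).exists_bound_of_continuousOn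
        (hgc.mono (closedBall_half_subset.trans openStrip_subset))
      -- Only finiteness matters here, as the norm is read off the boundary. Off the ball, ‖z + 1/2‖
      -- ≤ ‖z - 1/2‖ + 1 ≤ 5‖z - 1/2‖.
      refine ⟨max C (5 * ‖f‖), fun z hz => ?_⟩
      by_cases hb : z ∈ Metric.closedBall (1 / 2 : ℂ) (1 / 4)
      · exact (hC z hb).trans (le_max_left _ _)
      · refine le_max_of_le_right ?_
        rw [Metric.mem_closedBall, dist_eq_norm, not_le] at hb
        rw [hgz z fun h => by rw [h, sub_self, norm_zero] at hb; linarith, norm_smul, norm_div]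
        refine mul_le_mul ?_ (norm_le_of_mem f hz) (norm_nonneg _) (by norm_num)
        rw [div_le_iff₀ (by linarith)]
        have h1 : ‖z + 1 / 2‖ ≤ ‖z - 1 / 2‖ + 1 := by
          calc _ = ‖(z - 1 / 2) + 1‖ := by congr 1; ring
            _ ≤ _ := (norm_add_le _ _).trans (by rw [norm_one])
        linarith)
    (fun t => hgz _ (hne _ (by rw [leftPt_re]; norm_num)))
    (fun t => hgz _ (hne _ (by rw [rightPt_re]; norm_num)))
    (by
      have hc := continuous_rightPt
      exact Continuous.div (by fun_prop) (by fun_prop) fun t =>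
        sub_ne_zero.2 (hne _ (by rw [rightPt_re]; norm_num)))
    (fun t => hle _ (Or.inl (leftPt_re t))) (fun t => hle _ (Or.inr (rightPt_re t)))
  refine ⟨h, Subtype.ext (funext fun z => ?_), hn⟩
  rw [coe_blaschkeMul, hh]
  dsimp only
  rcases eq_or_ne z (1 / 2) with rfl | hz
  · rw [blaschke_half, zero_smul, hf]
  · by_cases hzs : z ∈ closedStrip
    · rw [hgz z hz, smul_smul, blaschke, div_mul_div_comm, mul_comm,
        div_self (mul_ne_zero (add_half_ne_zero hzs.1) (sub_ne_zero.2 hz)), one_smul]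
    · rw [hgz z hz, f.isCalderon.zero_off z hzs, smul_zero, smul_zero]

theorem analyticAt_half (f : CalderonSpace) : AnalyticAt ℂ (f : ℂ → EllInfty) (1 / 2) :=
  f.isCalderon.differentiableOn.analyticAt (isOpen_openStrip.mem_nhds half_mem)

theorem taylor_apply {k : ℕ} (f : CalderonSpace) (i : Fin k) :
    taylor k f i =
      ((i : ℕ).factorial : ℂ)⁻¹ • iteratedDeriv (i : ℕ) (f : ℂ → EllInfty) (1 / 2) := rfl

/-- Orders of vanishing add under products, so this form replaces any Leibniz computation with
Taylor coefficients. -/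
theorem taylor_eq_zero_iff (k : ℕ) (f : CalderonSpace) :
    taylor k f = 0 ↔ (k : ℕ∞) ≤ analyticOrderAt (f : ℂ → EllInfty) (1 / 2) := by
  rw [natCast_le_analyticOrderAt_iff_iteratedDeriv_eq_zero f.analyticAt_half]
  constructor
  · intro h i hi
    have h1 : (i.factorial : ℂ) • taylor k f ⟨i, hi⟩ = (i.factorial : ℂ) • (0 : EllInfty) := by
      rw [h]; rfl
    rwa [taylor_apply, smul_inv_smul₀ (Nat.cast_ne_zero.2 i.factorial_ne_zero),
      smul_zero] at h1
  · intro h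
    funext i
    rw [taylor_apply, h i i.2, smul_zero]; rfl

theorem taylor_blaschkeMul_eq_zero {k : ℕ} {g : CalderonSpace} (hg : taylor k g = 0) :
    taylor (k + 1) (blaschkeMul g) = 0 := by
  rw [taylor_eq_zero_iff] at hg ⊢
  have h := analyticOrderAt_smul analyticAt_blaschke g.analyticAt_half
  have h1 : (1 : ℕ∞) ≤ analyticOrderAt blaschke (1 / 2) := by
    rw [Order.one_le_iff_pos, pos_iff_ne_zero]
    exact analyticAt_blaschke.analyticOrderAt_ne_zero.2 blaschke_half
  rw [coe_blaschkeMul, show (fun z => blaschke z • g z) = blaschke • (g : ℂ → EllInfty) from rfl, h,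
    Nat.cast_add, Nat.cast_one, add_comm]
  exact add_le_add h1 hg

theorem taylor_zero_apply {k : ℕ} (f : CalderonSpace) : taylor (k + 1) f 0 = f (1 / 2) := by
  simp [taylor_apply]

end CalderonSpace

/-! ### The extension of ℓ_2 by a Rochberg space, and its type -/

namespace RochbergSpace

open CalderonSpace

variable {k m : ℕ}

/-- The list of Taylor coefficients as an element of the Rochberg space. -/
def jet (m : ℕ) : CalderonSpace →ₗ[ℂ] RochbergSpace m := (taylor m).rangeRestrict

/-- The underlying list of an element of the Rochberg space. -/
def coeffs (m : ℕ) : RochbergSpace m →ₗ[ℂ] (Fin m → EllInfty) := (LinearMap.range (taylor m)).subtype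

theorem jet_eq_iff {f : CalderonSpace} {w : RochbergSpace m} : jet m f = w ↔ taylor m f = w.1 :=
  Subtype.ext_iff

theorem jet_eq_zero_iff {f : CalderonSpace} : jet m f = 0 ↔ taylor m f = 0 :=
  Subtype.ext_iff

theorem norm_jet_le (f : CalderonSpace) : ‖jet m f‖ ≤ ‖f‖ := norm_le rfl

theorem exists_jet_eq (w : RochbergSpace m) : ∃ f : CalderonSpace, jet m f = w ∧ ‖f‖ ≤ 2 * ‖w‖ := by
  rcases eq_or_ne w 0 with rfl | hw
  · exact ⟨0, map_zero _, by simp⟩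
  · by_contra! h
    have h1 : 2 * ‖w‖ ≤ ‖w‖ := le_norm fun f hf => (h f (jet_eq_iff.2 hf)).le
    linarith [norm_pos_iff.2 hw]

theorem sum_sq_zero_le (w : RochbergSpace (k + 1)) (s : Finset ℕ) :
    ∑ n ∈ s, ‖coeffs (k + 1) w 0 n‖ ^ 2 ≤ ‖w‖ ^ 2 := by
  refine (Real.sqrt_le_left (norm_nonneg w)).1 (le_norm fun f hf => ?_)
  refine Real.sqrt_le_iff.2 ⟨norm_nonneg f, ?_⟩
  have h : coeffs (k + 1) w 0 = f (1 / 2) := (congrFun hf 0).symm.trans (taylor_zero_apply f)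
  rw [h]
  exact sum_sq_half_le f s

/-- The value at `1/2`, as a map of the Rochberg space into `ℓ_2`. -/
def valueMap (k : ℕ) : RochbergSpace (k + 1) →ₗ[ℂ] lp (fun _ : ℕ => ℂ) 2 where
  toFun w := ⟨fun n => coeffs (k + 1) w 0 n, memℓp_gen' (C := ‖w‖ ^ 2) fun s => by
    simpa using sum_sq_zero_le w s⟩
  map_add' v w := lp.ext (funext fun n =>
    congrArg (fun c : Fin (k + 1) → EllInfty => c 0 n) (map_add (coeffs (k + 1)) v w))
  map_smul' c w := lp.ext (funext fun n =>
    congrArg (fun a : Fin (k + 1) → EllInfty => a 0 n) (map_smul (coeffs (k + 1)) c w))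

theorem norm_valueMap_le (w : RochbergSpace (k + 1)) : ‖valueMap k w‖ ≤ ‖w‖ :=
  lp.norm_le_of_forall_sum_le (by norm_num) (norm_nonneg _) fun s => by
    have h := sum_sq_zero_le w s
    simpa using! h

theorem valueMap_jet_apply (f : CalderonSpace) (n : ℕ) : valueMap k (jet (k + 1) f) n = f (1 / 2) n :=
  congrArg (fun x : EllInfty => x n) (taylor_zero_apply f)

theorem exists_valueMap_eq (b : lp (fun _ : ℕ => ℂ) 2) :
    ∃ w, valueMap k w = b ∧ ‖w‖ ≤ 2 * ‖b‖ := by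
  obtain ⟨f, hf, hfb⟩ := exists_half_eq b
  exact ⟨jet (k + 1) f, lp.ext (funext fun n => (valueMap_jet_apply f n).trans (hf n)),
    (norm_jet_le f).trans hfb⟩

/-- Choose a nearly optimal representative, which vanishes at 1/2, and divide it by `blaschke`: 6 =
3 · 2. -/
theorem exists_jet_blaschkeMul_eq (δ : LinearMap.ker (valueMap k)) :
    ∃ h : CalderonSpace, jet (k + 1) (blaschkeMul h) = δ ∧ ‖h‖ ≤ 6 * ‖δ‖ := by
  obtain ⟨f, hf, hfn⟩ := exists_jet_eq (δ : RochbergSpace (k + 1))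
  have h0 : f (1 / 2) = 0 := lp.ext (funext fun n => by
    rw [← valueMap_jet_apply (k := k), hf, LinearMap.mem_ker.1 δ.2]; rfl)
  obtain ⟨h, hh, hhn⟩ := exists_blaschkeMul_eq f h0
  refine ⟨h, by rw [hh, hf], ?_⟩
  rw [Submodule.coe_norm]
  linarith

/-- If g has the k-jet of h, the difference h - g vanishes to order k. After multiplication by
`blaschke` it vanishes to order k + 1, so g competes in the infimum on the left. -/
theorem norm_jet_blaschkeMul_le (h : CalderonSpace) :
    ‖jet (k + 1) (blaschkeMul h)‖ ≤ ‖jet k h‖ := by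
  refine le_norm fun g hg => ?_
  have h1 : taylor k (h - g) = 0 := by rw [map_sub, hg]; exact sub_self _
  have h2 := jet_eq_zero_iff.2 (taylor_blaschkeMul_eq_zero h1)
  rw [map_sub, map_sub, sub_eq_zero] at h2
  rw [h2]
  exact (norm_jet_le _).trans (norm_blaschkeMul_le g)

/-- The choice F of preimages need not be additive: signed sums are compared after multiplication by
`blaschke`, which is linear. -/
theorem hasLogType_ker_valueMap {d : ℕ} (h : HasLogType (RochbergSpace k) d) :
    HasLogType (LinearMap.ker (valueMap k)) d := by
  choose F hF hFn using exists_jet_blaschkeMul_eq (k := k)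
  refine h.transfer (fun δ => jet k (F δ)) 6 (fun δ => (norm_jet_le _).trans (hFn δ)) fun r x ε => ?_
  have h1 : ((∑ i, ε i • x i : LinearMap.ker (valueMap k)) : RochbergSpace (k + 1)) =
      jet (k + 1) (blaschkeMul (∑ i, ε i • F (x i))) := by
    rw [map_sum_intUnits_smul, map_sum_intUnits_smul]
    simp only [hF]
    exact map_sum_intUnits_smul (LinearMap.ker (valueMap k)).subtype ε x
  rw [Submodule.coe_norm, h1, ← map_sum_intUnits_smul]
  refine (norm_jet_blaschkeMul_le _).trans ?_
  linarith [norm_nonneg (jet k (∑ i, ε i • F (x i)))]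

/-- With a single coefficient the value at 1/2 determines the element, so 𝒵_1 is ℓ_2 up to a factor
2. -/
theorem norm_le_valueMap (w : RochbergSpace 1) : ‖w‖ ≤ 2 * ‖valueMap 0 w‖ := by
  obtain ⟨v, hv, hvn⟩ := exists_valueMap_eq (k := 0) (valueMap 0 w)
  have h : w = v := Subtype.ext (funext fun i => by
    rw [Subsingleton.elim i 0]
    exact lp.ext (funext fun n => (congrArg (fun x : lp (fun _ : ℕ => ℂ) 2 => x n) hv).symm))
  rw [← h] at hvn
  exact hvn

theorem hasLogType (k : ℕ) : HasLogType (RochbergSpace (k + 1)) k := by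
  induction k with
  | zero =>
    refine (hasLogType_of_inner (lp (fun _ : ℕ => ℂ) 2)).of_antilipschitz
      ((valueMap 0).mkContinuous 1 fun w => by rw [one_mul]; exact norm_valueMap_le w)
      (c := 1 / 2) (by norm_num) fun w => ?_
    rw [LinearMap.mkContinuous_apply]
    linarith [norm_le_valueMap w]
  | succ k ih =>
    exact (hasLogType_ker_valueMap ih).extension (valueMap (k + 1))
      (hasLogType_of_inner (lp (fun _ : ℕ => ℂ) 2)) (D := 1)
      (fun w => by rw [one_mul]; exact norm_valueMap_le w) exists_valueMap_eq

end RochbergSpace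

/-! ### The lower bound and the theorem -/

namespace CalderonSpace

/-- The constant function with value the `n`-th unit vector. -/
theorem exists_unit (n : ℕ) :
    ∃ f : CalderonSpace, (∀ z ∈ closedStrip, ∀ j, f z j = if j = n then 1 else 0) ∧ ‖f‖ ≤ 1 := by
  have hsum : HasSum (fun j => ‖(if j = n then 1 else 0 : ℂ)‖ * Real.exp (0 : ℝ)) 1 := by
    have h := hasSum_ite_eq n (1 : ℝ)
    refine h.congr_fun fun j => ?_
    split_ifs <;> simp
  obtain ⟨f, hf, hfn⟩ := exists_exp (fun j => if j = n then 1 else 0) (fun _ => 0) (M := 1)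
    (tendsto_const_nhds.congr' <| by
      filter_upwards [eventually_gt_atTop n] with j hj
      rw [if_neg hj.ne'])
    (fun j => by split_ifs <;> simp) hsum.summable hsum.tsum_eq.le
  exact ⟨f, fun z hz j => by simpa using hf z hz j, hfn⟩

end CalderonSpace

namespace RochbergSpace

open CalderonSpace

/-- The Rochberg norm of a sum of `n` signed unit vectors in the last coordinate. -/
theorem le_norm_sum_unit {ι : Type*} [Fintype ι] [DecidableEq ι] (p : ℕ) (φ : ι → ℕ)
    (hφ : Function.Injective φ) (e : ι → CalderonSpace)
    (he : ∀ i, ∀ z ∈ closedStrip, ∀ j, e i z j = if j = φ i then 1 else 0)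
    (hι : 0 < Fintype.card ι) (ε : ι → ℤˣ) :
    √(Fintype.card ι : ℝ) * |Real.log (Fintype.card ι : ℝ)| ^ p ≤
      p.factorial * 4 ^ p * ‖jet (p + 1) (∑ i, ε i • e i)‖ := by
  set n : ℝ := (Fintype.card ι : ℝ) with hn
  have hn0 : 0 < n := Nat.cast_pos.2 hι
  have hK : (0 : ℝ) < p.factorial * 4 ^ p := by positivity
  rw [← div_le_iff₀' hK]
  refine le_norm fun f hf => ?_
  rw [div_le_iff₀' hK]
  set L : ℝ := Real.log n with hL
  set u : CalderonSpace := f - ∑ i, ε i • e i with hu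
  have hu0 : ((p + 1 : ℕ) : ℕ∞) ≤ analyticOrderAt (u : ℂ → EllInfty) (1 / 2) := by
    rw [← taylor_eq_zero_iff, hu, map_sub, hf]
    exact sub_self _
  -- Pairing with the same signs makes Λ equal to n on the signed sum, since ε_i² = 1.
  let Λ : EllInfty →L[ℂ] ℂ := ∑ i, ((ε i : ℤ) : ℂ) • lpCoord ∞ (φ i)
  have hΛ : ∀ x : EllInfty, Λ x = ∑ i, ((ε i : ℤ) : ℂ) * x (φ i) := fun x => by
    simp only [Λ, _root_.sum_apply]; rfl
  have hΛe : ∀ z ∈ closedStrip, Λ ((∑ i, ε i • e i : CalderonSpace) z) = n := fun z hz => by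
    have h1 : ∀ i, (∑ j, ε j • e j : CalderonSpace) z (φ i) = ((ε i : ℤ) : ℂ) := fun i => by
      let ev : CalderonSpace →+ ℂ :=
        { toFun := fun g => g z (φ i), map_zero' := rfl, map_add' := fun _ _ => rfl }
      refine (map_sum_intUnits_smul ev ε e).trans ?_
      have h2 : ∀ j, ε j • ev (e j) = if j = i then ((ε i : ℤ) : ℂ) else 0 := fun j => by
        have h3 : ev (e j) = if j = i then 1 else 0 := by
          refine (he j z hz (φ i)).trans ?_
          simp only [hφ.eq_iff, eq_comm]
        rw [h3, Units.smul_def, zsmul_eq_mul]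
        split_ifs with h
        · rw [h, mul_one]
        · rw [mul_zero]
      simp only [h2, sum_ite_eq', mem_univ, if_true]
    rw [hΛ]
    simp only [h1, ← Int.cast_mul, ← Units.val_mul, Int.units_mul_self]
    simp [hn]
  -- The factor n^z balances the two sides: |Λ f| is at most n‖f‖ on Re z = 0 but at most ‖f‖ on Re
  -- z = 1, so G is bounded by n‖f‖ throughout.
  let G : ℂ → ℂ := fun z => Complex.exp (L * z) * Λ (f z)
  have hG : ∀ z ∈ closedStrip, ‖G z‖ ≤ n * ‖f‖ := fun z hz => by
    have hε : ∀ i, ‖((ε i : ℤ) : ℂ)‖ = 1 := fun i => by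
      rcases Int.units_eq_one_or (ε i) with h | h <;> simp [h]
    have h := norm_sum_exp_le f univ φ hφ (fun i => ((ε i : ℤ) : ℂ)) (fun _ => L) (M := n)
      (by simp only [hε]; simp [hn])
      (fun i _ => by rw [hε, one_mul, hL, Real.exp_log hn0]) hz
    refine le_trans (le_of_eq ?_) h
    congr 1
    simp only [G, hΛ, mul_sum]
    exact sum_congr rfl fun i _ => by rw [mul_comm z]; ring
  have hGd : DifferentiableOn ℂ G openStrip := by
    refine DifferentiableOn.mul (by fun_prop) ?_
    exact Λ.differentiable.comp_differentiableOn f.isCalderon.differentiableOn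
  have hcauchy : ‖iteratedDeriv p G (1 / 2)‖ ≤ p.factorial * (n * ‖f‖) / (1 / 4) ^ p :=
    Complex.norm_iteratedDeriv_le_of_forall_mem_sphere_norm_le p (by norm_num)
      ((hGd.mono closedBall_half_subset).diffContOnCl_ball le_rfl)
      fun z hz => hG z (openStrip_subset (closedBall_half_subset (Metric.sphere_subset_closedBall hz)))
  -- The contribution of f minus the constant signed sum. It vanishes to order p + 1 at 1/2, so the
  -- p-th derivative of G there is that of n·n^z.
  let H : ℂ → EllInfty := (fun z => Complex.exp (L * z)) • (u : ℂ → EllInfty)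
  have hEa : AnalyticAt ℂ (fun z : ℂ => Complex.exp (L * z)) (1 / 2) := by fun_prop
  have hHa : AnalyticAt ℂ H (1 / 2) := hEa.smul u.analyticAt_half
  have hH : iteratedDeriv p H (1 / 2) = 0 := by
    refine (natCast_le_analyticOrderAt_iff_iteratedDeriv_eq_zero (n := p + 1) hHa).1 ?_ p (by omega)
    rw [analyticOrderAt_smul hEa u.analyticAt_half]
    exact hu0.trans le_add_self
  have hΛH : iteratedDeriv p (Λ ∘ H) (1 / 2) = 0 := by
    rw [iteratedDeriv_eq_iteratedFDeriv, Λ.iteratedFDeriv_comp_left hHa.contDiffAt le_rfl]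
    change Λ (iteratedFDeriv ℂ p H (1 / 2) fun _ => 1) = 0
    rw [← iteratedDeriv_eq_iteratedFDeriv, hH, map_zero]
  have hGH : G =ᶠ[𝓝 (1 / 2)] (Λ ∘ H) + fun z => (n : ℂ) * Complex.exp (L * z) := by
    filter_upwards [isOpen_openStrip.mem_nhds half_mem] with z hz
    have h1 : f z = u z + (∑ i, ε i • e i : CalderonSpace) z := by
      rw [← CalderonSpace.add_apply, hu, sub_add_cancel]
    change Complex.exp (L * z) * Λ (f z) =
      Λ (Complex.exp (L * z) • u z) + (n : ℂ) * Complex.exp (L * z)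
    rw [h1, map_add, hΛe z (openStrip_subset hz), map_smul, smul_eq_mul]
    ring
  have hGp : iteratedDeriv p G (1 / 2) = n * (L ^ p * Complex.exp (L * (1 / 2))) := by
    rw [hGH.iteratedDeriv_eq, iteratedDeriv_add
      ((Λ.analyticAt _).comp hHa).contDiffAt (by fun_prop), hΛH, zero_add,
      iteratedDeriv_const_mul_field, iteratedDeriv_cexp_const_mul]
  have hsqrt : Real.exp (L * (1 / 2)) = √n := by
    rw [hL, Real.sqrt_eq_rpow, Real.rpow_def_of_pos hn0]
  rw [hGp, show (L : ℂ) * (1 / 2) = ((L * (1 / 2) : ℝ) : ℂ) by push_cast; ring,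
    ← Complex.ofReal_exp, hsqrt, norm_mul, norm_mul, norm_pow, Complex.norm_real, Complex.norm_real,
    Complex.norm_real, Real.norm_of_nonneg hn0.le, Real.norm_of_nonneg (Real.sqrt_nonneg n),
    Real.norm_eq_abs] at hcauchy
  refine le_of_mul_le_mul_left ?_ hn0
  calc _ = n * (|L| ^ p * √n) := by ring
    _ ≤ _ := hcauchy
    _ = _ := by rw [one_div, inv_pow, div_inv_eq_mul]; ring

/-- The growth rate of the type `2` constants of a Rochberg space is optimal. -/
theorem le_of_hasLogType {p d : ℕ} (h : HasLogType (RochbergSpace (p + 1)) d) : p ≤ d := by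
  obtain ⟨C, hC, h⟩ := h
  by_contra! hdp
  choose e he hen using exists_unit
  set K : ℝ := p.factorial * 4 ^ p with hK
  have hK0 : 0 < K := by positivity
  set l : ℝ := Real.log 2 with hl
  have hl0 : 0 < l := Real.log_pos one_lt_two
  have key : ∀ r : ℕ, ((r : ℝ) * l) ^ (2 * p) ≤ K ^ 2 * (C * ((r : ℝ) + 1) ^ (2 * d)) := by
    intro r
    let φ : DyadicIdx r → ℕ := fun i => Fintype.equivFin _ i
    have hφ : Function.Injective φ := Fin.val_injective.comp (Equiv.injective _)
    let x : DyadicIdx r → RochbergSpace (p + 1) := fun i => jet (p + 1) (e (φ i))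
    set n : ℝ := 2 ^ r with hn
    have hn0 : 0 < n := by positivity
    have hcard : (Fintype.card (DyadicIdx r) : ℝ) = n := by rw [DyadicIdx.card]; push_cast; rfl
    have hx : ∑ i, ‖x i‖ ^ 2 ≤ n := by
      calc _ ≤ ∑ _i : DyadicIdx r, (1 : ℝ) := sum_le_sum fun i _ =>
            pow_le_one₀ (norm_nonneg _) ((norm_jet_le _).trans (hen _))
        _ = n := by rw [sum_const, card_univ, nsmul_one, hcard]
    have hlow : n * ((r : ℝ) * l) ^ (2 * p) / K ^ 2 ≤ sqAvg x := by
      refine le_sqAvg_of_forall fun ε => ?_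
      rw [div_le_iff₀' (by positivity), ← mul_pow]
      have h1 := le_norm_sum_unit p φ hφ (fun i => e (φ i)) (fun i => he (φ i))
        (by rw [DyadicIdx.card]; positivity) ε
      rw [hcard, map_sum_intUnits_smul, hn, Real.log_pow, ← hn,
        abs_of_nonneg (by positivity)] at h1
      have h2 := pow_le_pow_left₀ (by positivity) h1 2
      rw [mul_pow, Real.sq_sqrt hn0.le, ← pow_mul, mul_comm p] at h2
      exact h2
    have h3 := hlow.trans ((h r x).trans (mul_le_mul_of_nonneg_left hx (by positivity)))
    rw [div_le_iff₀ (by positivity)] at h3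
    refine le_of_mul_le_mul_left (h3.trans_eq ?_) hn0
    ring
  -- Since d < p gives 2d + 1 ≤ 2p, one spare power of r suffices to beat the constant; r + 1 ≤ 2r
  -- accounts for the factor 2^(2d).
  obtain ⟨r, hr⟩ := exists_nat_gt (max 1 (K ^ 2 * (C * 2 ^ (2 * d)) / l ^ (2 * p)))
  have hr1 : (1 : ℝ) < r := (le_max_left _ _).trans_lt hr
  have hr2 := (le_max_right _ _).trans_lt hr
  rw [div_lt_iff₀ (by positivity)] at hr2
  have h1 : ((r : ℝ) + 1) ^ (2 * d) ≤ (2 * r) ^ (2 * d) := by gcongr; linarith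
  have h2 : (r : ℝ) ^ (2 * d + 1) ≤ (r : ℝ) ^ (2 * p) := pow_le_pow_right₀ hr1.le (by omega)
  have h3 : (0 : ℝ) < (r : ℝ) ^ (2 * d) := by positivity
  have h4 : ((r : ℝ) * l) ^ (2 * p) < (r : ℝ) ^ (2 * p) * l ^ (2 * p) := by
    calc _ ≤ K ^ 2 * (C * ((r : ℝ) + 1) ^ (2 * d)) := key r
      _ ≤ K ^ 2 * (C * (2 * r) ^ (2 * d)) := by gcongr
      _ = (r : ℝ) ^ (2 * d) * (K ^ 2 * (C * 2 ^ (2 * d))) := by ring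
      _ < (r : ℝ) ^ (2 * d) * (r * l ^ (2 * p)) := by gcongr
      _ = (r : ℝ) ^ (2 * d + 1) * l ^ (2 * p) := by ring
      _ ≤ _ := by gcongr
  rw [mul_pow] at h4
  exact lt_irrefl _ h4

theorem not_embedsIn {m k : ℕ} (hk : 1 ≤ k) (hkm : k < m) {Z : Type*} [NormedAddCommGroup Z]
    [NormedSpace ℂ Z] (hZ : HasLogType Z (k - 1)) : ¬ EmbedsIn (RochbergSpace m) Z := by
  rintro ⟨T, c, hc, hT⟩
  obtain ⟨p, rfl⟩ : ∃ p, m = p + 1 := ⟨m - 1, by omega⟩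
  have := le_of_hasLogType (hZ.of_antilipschitz T hc hT)
  omega

end RochbergSpace

end

theorem mainTheorem3 (m k : ℕ) (hk : 1 ≤ k) (hkm : k < m) :
    (∀ (Z : Type*) [NormedAddCommGroup Z] [NormedSpace ℂ Z],
      IsTwistedHilbert k Z → ¬ EmbedsIn (RochbergSpace m) Z) ∧
    ¬ EmbedsIn (RochbergSpace m) (RochbergSpace k) := by
  refine ⟨fun Z _ _ hZ => RochbergSpace.not_embedsIn hk hkm hZ.hasLogType,
    RochbergSpace.not_embedsIn hk hkm ?_⟩
  -- Only the type estimate for 𝒵_k enters, not its being a twisted Hilbert space.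
  have h := RochbergSpace.hasLogType (k - 1)
  rwa [Nat.sub_add_cancel hk] at h
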